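/- Let $d, N$ be non-negative integers and write $\langle z\rangle=(1+|x|^2+|\xi|^2)^{1/2}$ for $z=(x,\xi)\in\mathbb{R}^{2d}$. Let $\Phi:\mathbb{R}^{2d}\to\mathbb{R}$, $\Phi=\Phi(x,\eta)$, be a phase function such that (i) $\Phi\in C^\infty(\mathbb{R}^{2d})$; (ii) for every multi-index $\alpha$ with $|\alpha|\ge 2$ there is a constant $C_\alpha$ with $|\partial_z^\alpha\Phi(z)|\le C_\alpha$ for all $z\in\mathbb{R}^{2d}$; (iii) there is $\delta>0$ with $|\det\partial^2_{x,\eta}\Phi(x,\eta)|\ge\delta$ for all $(x,\eta)\in\mathbb{R}^{2d}$. Let $\sigma\in L^\infty(\mathbb{R}^{2d})$ be a complex-valued symbol all of whose distributional derivatives $\partial_z^\alpha\sigma$ with $|\alpha|\le 2N$ belong to $L^\infty(\mathbb{R}^{2d})$, and let $T$ be the Fourier integral operator $$Tf(x)=\int_{\mathbb{R}^d}e^{2\pi i\Phi(x,\eta)}\sigma(x,\eta)\hat f(\eta)\,d\eta,\qquad \hat f(\eta)=\int_{\mathbb{R}^d}f(t)e^{-2\pi i t\cdot\eta}\,dt .$$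 Let $g\in\mathcal{S}(\mathbb{R}^d)$, let $a,b>0$, let $\Lambda=a\mathbb{Z}^d\times b\mathbb{Z}^d$, and for $(m,n)\in\Lambda$ put $g_{m,n}(t)=e^{2\pi i n\cdot t}g(t-m)$. (In particular, $g$ may generate a tight Gabor frame $\{g_{m,n}\}_{(m,n)\in\Lambda}$ of $L^2(\mathbb{R}^d)$.) Then the system $$y=\nabla_\eta\Phi(x,\eta),\qquad \xi=\nabla_x\Phi(x,\eta)$$ has, for every $(y,\eta)\in\mathbb{R}^{2d}$, exactly one solution $(x,\xi)=:\chi(y,\eta)$. The map $\chi$ (the canonical transformation generated by $\Phi$) is a smooth diffeomorphism of $\mathbb{R}^{2d}$, $\chi$ and $\chi^{-1}$ are Lipschitz continuous, and $\chi$ preserves the symplectic form, $dx\wedge d\xi=dy\wedge d\eta$. Moreover there is a constant $C_N>0$ such that $$|\langle Tg_{m,n},g_{m',n'}\rangle|\le C_N\,\langle\chi(m,n)-(m',n')\rangle^{-2N}\qquad\text{for all }(m,n),(m',n')\in\Lambda,$$ where $\langle f,h\rangle=\int_{\mathbb{R}^d} f(t)\overline{h(t)}\,dt$. -/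

import Mathlib

open MeasureTheory FourierTransform
open scoped ContDiff

noncomputable section

namespace FourierOp

/-- The Euclidean space `ℝ^d`. -/
abbrev Eu (d : ℕ) : Type := EuclideanSpace ℝ (Fin d)

/-- The space `ℝ^{2d} = ℝ^d × ℝ^d`, with Lebesgue (product) measure. -/
abbrev Phase (d : ℕ) : Type := Eu d × Eu d

/-- `⟨(x, ξ)⟩ = (1 + |x|² + |ξ|²)^{1/2}`, with Euclidean norms. -/
def bracket {d : ℕ} (p : Phase d) : ℝ :=
  Real.sqrt (1 + ‖p.1‖ ^ 2 + ‖p.2‖ ^ 2)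

/-- The standard basis vector `e_i` of `ℝ^d`. -/
def stdVec {d : ℕ} (i : Fin d) : Eu d := EuclideanSpace.single i (1 : ℝ)

/-- The standard basis of `ℝ^{2d}`: `inl i` is the direction of `x_i`, `inr j` that of `η_j`. -/
def phaseVec {d : ℕ} : Fin d ⊕ Fin d → Phase d
  | Sum.inl i => (stdVec i, 0)
  | Sum.inr j => (0, stdVec j)

/-! ### The phase function -/

/-- The gradient `∇_x Φ (x, η)` in the first variable. -/
def gradX {d : ℕ} (Φ : Phase d → ℝ) (x η : Eu d) : Eu d :=
  gradient (fun x' : Eu d => Φ (x', η)) x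

/-- The gradient `∇_η Φ (x, η)` in the second variable. -/
def gradEta {d : ℕ} (Φ : Phase d → ℝ) (x η : Eu d) : Eu d :=
  gradient (fun η' : Eu d => Φ (x, η')) η

/-- The matrix `∂²_{x,η} Φ (z) = (∂_{x_i} ∂_{η_j} Φ (z))_{i,j}`. -/
def mixedHessian {d : ℕ} (Φ : Phase d → ℝ) (z : Phase d) : Matrix (Fin d) (Fin d) ℝ :=
  Matrix.of fun i j =>
    fderiv ℝ (fun w : Phase d => fderiv ℝ Φ w (phaseVec (Sum.inr j))) z (phaseVec (Sum.inl i))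

/-- The phase functions: smooth, real-valued, with all derivatives of order at least two bounded,
and with `|det ∂²_{x,η} Φ| ≥ δ` everywhere for some `δ > 0`. -/
structure IsPhase {d : ℕ} (Φ : Phase d → ℝ) : Prop where
  smooth : ContDiff ℝ ∞ Φ
  bounded : ∀ k : ℕ, 2 ≤ k → ∃ C : ℝ, ∀ z : Phase d, ‖iteratedFDeriv ℝ k Φ z‖ ≤ C
  nondegenerate : ∃ δ : ℝ, 0 < δ ∧ ∀ z : Phase d, δ ≤ |(mixedHessian Φ z).det|

/-! ### The symbol -/

/-- `w` is the distributional derivative `∂_{I 0} ⋯ ∂_{I (k-1)} σ` on `ℝ^{2d}`, where each `I j` is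
one of the `2d` coordinate directions. (As `I` varies these are the `∂^α σ` with `|α| = k`.) -/
def IsWeakPartial {d k : ℕ} (I : Fin k → Fin d ⊕ Fin d) (σ w : Phase d → ℂ) : Prop :=
  ∀ φ : Phase d → ℂ, ContDiff ℝ ∞ φ → HasCompactSupport φ →
    ∫ z, σ z * iteratedFDeriv ℝ k φ z (fun j => phaseVec (I j)) = (-1) ^ k * ∫ z, w z * φ z

/-- `σ` is (measurable and) essentially bounded, and all its distributional derivatives of order
at most `K` are essentially bounded functions. -/
def IsSymbol {d : ℕ} (K : ℕ) (σ : Phase d → ℂ) : Prop :=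
  MemLp σ ⊤ volume ∧
    ∀ k : ℕ, k ≤ K → ∀ I : Fin k → Fin d ⊕ Fin d,
      ∃ w : Phase d → ℂ, MemLp w ⊤ volume ∧ IsWeakPartial I σ w

/-! ### The operator and the Gabor system -/

/-- The Fourier integral operator
`T f (x) = ∫ e^{2πi Φ(x,η)} σ(x,η) f̂(η) dη`, with `f̂(η) = ∫ f(t) e^{-2πi t·η} dt`. -/
def fio {d : ℕ} (Φ : Phase d → ℝ) (σ : Phase d → ℂ) (f : Eu d → ℂ) (x : Eu d) : ℂ :=
  ∫ η : Eu d, Complex.exp (2 * Real.pi * Complex.I * (Φ (x, η) : ℂ)) * σ (x, η) * 𝓕 f η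

/-- The time-frequency shift `g_{m,n} = M_n T_m g`, that is `t ↦ e^{2πi n·t} g(t - m)`. -/
def gaborAtom {d : ℕ} (g : Eu d → ℂ) (m n : Eu d) (t : Eu d) : ℂ :=
  Complex.exp (2 * Real.pi * Complex.I * (inner ℝ n t : ℂ)) * g (t - m)

/-- The pairing `⟨f, h⟩ = ∫ f(t) conj(h(t)) dt`. -/
def pairing {d : ℕ} (f h : Eu d → ℂ) : ℂ :=
  ∫ t : Eu d, f t * (starRingEnd ℂ) (h t)

/-- The lattice `Λ = a ℤ^d × b ℤ^d` in `ℝ^{2d}`. -/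
def gaborLattice (d : ℕ) (a b : ℝ) : Set (Phase d) :=
  {p | (∀ i : Fin d, ∃ k : ℤ, p.1 i = a * k) ∧ ∀ i : Fin d, ∃ k : ℤ, p.2 i = b * k}

/-! ### Canonical transformations -/

/-- The symplectic form `dx ∧ dξ = ∑_j dx_j ∧ dξ_j` on `ℝ^{2d}`. -/
def symplecticForm {d : ℕ} (u v : Phase d) : ℝ :=
  inner ℝ u.1 v.2 - inner ℝ u.2 v.1

/-- A smooth bilipschitz canonical transformation of `ℝ^{2d}`: a smooth diffeomorphism, Lipschitz
together with its inverse, which preserves the symplectic form. -/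
structure IsCanonicalTransformation {d : ℕ} (χ : Phase d ≃ Phase d) : Prop where
  smooth : ContDiff ℝ ∞ χ
  smooth_symm : ContDiff ℝ ∞ χ.symm
  lipschitz : ∃ K : NNReal, LipschitzWith K χ
  lipschitz_symm : ∃ K : NNReal, LipschitzWith K χ.symm
  symplectic : ∀ p u v : Phase d,
    symplecticForm (fderiv ℝ χ p u) (fderiv ℝ χ p v) = symplecticForm u v

/-- `χ` is generated by `Φ`: `χ (y, η) = (x, ξ)` is the solution of the system
`y = ∇_η Φ (x, η)`, `ξ = ∇_x Φ (x, η)` with respect to `(x, ξ)`.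
At most one map `χ` has this property. -/
def IsGeneratedBy {d : ℕ} (Φ : Phase d → ℝ) (χ : Phase d → Phase d) : Prop :=
  ∀ y η x ξ : Eu d, χ (y, η) = (x, ξ) ↔ y = gradEta Φ x η ∧ ξ = gradX Φ x η

end FourierOp

end

/-! Put F(x, η) = (∇_η Φ, η) and G(x, η) = (x, ∇_x Φ), so that χ = G ∘ F⁻¹. The derivative of F is
block triangular with the mixed Hessian as its nontrivial diagonal block. Bounded second derivatives
and |det| ≥ δ bound its inverse uniformly, and bounded third derivatives make it Lipschitz. A
Hadamard-type global inverse theorem (`exists_homeomorph_contDiff_symm`) then makes F a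
diffeomorphism with Lipschitz inverse. Exchanging x and η gives the same for G. The symplectic
identity is d(dΦ) = 0: from ξ dx + y dη = dΦ follows dx ∧ dξ = dy ∧ dη.

For the decay, Fubini writes a matrix coefficient, up to a unimodular factor, as an integral over
phase space of σ times the window product conj g(x - m') ĝ(η - n), which is concentrated at p = (m',
n), times an oscillating exponential. Subtracting from Φ its linear part at p leaves a factor whose
derivatives grow only polynomially in |z - p|, and the Schwartz windows absorb this growth. What
remains of the phase is linear, and its coefficients are the residuals ∇_x Φ(m', n) - n' and ∇_η
Φ(m', n) - m (`defect`). Integrating by parts 2N times in each coordinate direction, with the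
derivatives falling on σ taken weakly, bounds the coefficient by the -2N-th power of every residual
(`exists_pow_mul_norm_integral_le`).

The two parts meet in `exists_canonicalTransformation`: |χ(m, n) - (m', n')| is at most a constant
times the size of the residuals. -/

/-! ### A global inverse function theorem -/

section GlobalInverse

open Metric Set Topology unitInterval

variable {E F : Type*} [NormedAddCommGroup E] [NormedAddCommGroup F]

/-- A map which is invertible on balls of a uniform size, with uniformly Lipschitz local inverses:
`f` is anti-Lipschitz on balls of radius `2 * r`, and the image of each ball of radius `r` contains
a ball of radius `ρ`. -/
structure IsUniformlyLocallyInvertible (f : E → F) (K r ρ : ℝ) : Prop where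
  K_pos : 0 < K
  r_pos : 0 < r
  rho_pos : 0 < ρ
  norm_sub_le : ∀ x, ∀ u ∈ closedBall x (2 * r), ∀ v ∈ closedBall x (2 * r),
    ‖u - v‖ ≤ K * ‖f u - f v‖
  surjOn : ∀ x, SurjOn f (closedBall x r) (closedBall (f x) ρ)

namespace IsUniformlyLocallyInvertible

variable {f : E → F} {K r ρ : ℝ}

theorem eq_of_mem_closedBall (h : IsUniformlyLocallyInvertible f K r ρ) {x u v : E}
    (hu : u ∈ closedBall x (2 * r)) (hv : v ∈ closedBall x (2 * r)) (huv : f u = f v) : u = v := by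
  have := h.norm_sub_le x u hu v hv
  rw [huv, sub_self, norm_zero, mul_zero] at this
  exact sub_eq_zero.1 (norm_le_zero_iff.1 this)

/-- A curve can be lifted through `f` if it stays `ρ`-close to a curve which can be lifted. -/
theorem exists_lift (h : IsUniformlyLocallyInvertible f K r ρ) {X : Type*} [TopologicalSpace X]
    {c : X → E} (hc : Continuous c) {β : X → F} (hβ : Continuous β)
    (hclose : ∀ s, ‖β s - f (c s)‖ ≤ ρ) :
    ∃ c' : X → E, Continuous c' ∧ (∀ s, f (c' s) = β s) ∧ ∀ s, β s = f (c s) → c' s = c s := by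
  choose c' hc' hfc' using fun s => h.surjOn (c s)
    (show β s ∈ closedBall (f (c s)) ρ from mem_closedBall_iff_norm.2 (hclose s))
  have hr := h.r_pos
  have hsub : ∀ x : E, closedBall x r ⊆ closedBall x (2 * r) := fun x =>
    closedBall_subset_closedBall (by linarith)
  refine ⟨c', ?_, hfc', fun s hs => ?_⟩
  -- The preimages are chosen pointwise; continuity comes from the anti-Lipschitz bound. Near `s₀`
  -- both `c' s` and `c' s₀` lie within `2 * r` of `c s₀`, which is why the bound is required on the
  -- doubled ball.
  · refine continuous_iff_continuousAt.2 fun s₀ => ?_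
    have hev : ∀ᶠ s in 𝓝 s₀, ‖c' s - c' s₀‖ ≤ K * ‖β s - β s₀‖ := by
      filter_upwards [hc.continuousAt (closedBall_mem_nhds (c s₀) hr)] with s hs
      rw [← hfc' s, ← hfc' s₀]
      refine h.norm_sub_le (c s₀) _ ?_ _ (hsub _ (hc' s₀))
      have h1 := mem_closedBall.1 (hc' s)
      have h2 : dist (c s) (c s₀) ≤ r := hs
      exact mem_closedBall.2 ((dist_triangle _ (c s) _).trans (by linarith))
    have hlim : Filter.Tendsto (fun s => K * ‖β s - β s₀‖) (𝓝 s₀) (𝓝 0) := by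
      have : ContinuousAt (fun s => K * ‖β s - β s₀‖) s₀ := by fun_prop
      simpa [ContinuousAt] using this
    exact tendsto_iff_norm_sub_tendsto_zero.2
      (squeeze_zero' (Filter.Eventually.of_forall fun _ => norm_nonneg _) hev hlim)
  · exact h.eq_of_mem_closedBall (hsub _ (hc' s)) (mem_closedBall_self (by linarith))
      ((hfc' s).trans hs)

variable [NormedSpace ℝ F]

/-- The uniform radius `ρ` makes the range closed as well as open: a limit point is within `ρ` of
some value, hence is itself a value. Connectedness of `F` concludes. -/
theorem surjective (h : IsUniformlyLocallyInvertible f K r ρ) : Function.Surjective f := by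
  have hopen : IsOpen (range f) := by
    rw [Metric.isOpen_iff]
    rintro _ ⟨x, rfl⟩
    refine ⟨ρ, h.rho_pos, fun y hy => ?_⟩
    obtain ⟨u, -, hu⟩ := h.surjOn x (ball_subset_closedBall hy)
    exact ⟨u, hu⟩
  have hclosed : IsClosed (range f) := by
    refine isClosed_of_closure_subset fun y hy => ?_
    obtain ⟨_, ⟨x, rfl⟩, hx⟩ := Metric.mem_closure_iff.1 hy ρ h.rho_pos
    obtain ⟨u, -, hu⟩ := h.surjOn x (mem_closedBall.2 hx.le)
    exact ⟨u, hu⟩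
  exact range_eq_univ.1 (IsClopen.eq_univ ⟨hclosed, hopen⟩ (range_nonempty f))

variable [NormedSpace ℝ E]

/-- If f x₀ = f x₁, the segment from x₀ to x₁ maps to a loop. Contracting the loop linearly in steps
of size at most `ρ` and lifting each stage with fixed endpoints gives a lift of a constant path from
x₀ to x₁. Local injectivity makes it constant. -/
theorem injective (h : IsUniformlyLocallyInvertible f K r ρ) (hf : Continuous f) :
    Function.Injective f := by
  intro x₀ x₁ hx
  set γ : I → E := fun s => x₀ + (s : ℝ) • (x₁ - x₀) with hγ
  have hγc : Continuous γ := by fun_prop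
  set δ : I → F := fun s => f (γ s) - f x₀ with hδ
  have hδc : Continuous δ := by fun_prop
  obtain ⟨B, hB⟩ := (isCompact_range hδc).isBounded.exists_norm_le
  obtain ⟨n, hn⟩ := exists_nat_gt (B / ρ)
  have hB0 : 0 ≤ B := (norm_nonneg _).trans (hB _ (mem_range_self 0))
  have hn0 : (0 : ℝ) < n := lt_of_le_of_lt (div_nonneg hB0 h.rho_pos.le) hn
  have hBn : B / n ≤ ρ := by
    rw [div_le_iff₀ hn0, mul_comm]
    exact ((div_lt_iff₀ h.rho_pos).1 hn).le
  have key : ∀ k : ℕ, ∃ c : I → E, Continuous c ∧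
      (∀ s, f (c s) = f x₀ + (1 - (k : ℝ) / n) • δ s) ∧ c 0 = x₀ ∧ c 1 = x₁ := by
    intro k
    induction k with
    | zero => exact ⟨γ, hγc, fun s => by simp [hδ], by simp [hγ], by simp [hγ]⟩
    | succ k ih =>
      obtain ⟨c, hc, hfc, h0, h1⟩ := ih
      have hδ0 : δ 0 = 0 := by simp [hδ, hγ]
      have hδ1 : δ 1 = 0 := by simp [hδ, hγ, hx]
      obtain ⟨c', hc', hfc', heq⟩ := h.exists_lift hc
        (β := fun s => f x₀ + (1 - ((k + 1 : ℕ) : ℝ) / n) • δ s) (by fun_prop) (fun s => by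
          have : f x₀ + (1 - ((k + 1 : ℕ) : ℝ) / n) • δ s - f (c s) = -((1 / (n : ℝ)) • δ s) := by
            rw [hfc, add_sub_add_left_eq_sub, ← sub_smul, ← neg_smul]
            congr 1
            push_cast
            field_simp
            ring
          rw [this, norm_neg, norm_smul, Real.norm_of_nonneg (by positivity)]
          calc 1 / (n : ℝ) * ‖δ s‖ ≤ 1 / (n : ℝ) * B := by
                gcongr
                exact hB _ (mem_range_self s)
            _ = B / n := by ring
            _ ≤ ρ := hBn)
      refine ⟨c', hc', hfc', ?_, ?_⟩
      · rw [heq 0 (by rw [hfc, hδ0, smul_zero, smul_zero]), h0]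
      · rw [heq 1 (by rw [hfc, hδ1, smul_zero, smul_zero]), h1]
  obtain ⟨c, hc, hfc, h0, h1⟩ := key n
  have hconst : ∀ s, f (c s) = f x₀ := fun s => by rw [hfc, div_self hn0.ne']; simp
  have hloc : IsLocallyConstant c := by
    rw [IsLocallyConstant.iff_eventually_eq]
    intro s₀
    have hr2 : 0 < 2 * r := by linarith [h.r_pos]
    filter_upwards [hc.continuousAt (closedBall_mem_nhds (c s₀) hr2)] with s hs
    exact h.eq_of_mem_closedBall hs (mem_closedBall_self hr2.le)
      ((hconst s).trans (hconst s₀).symm)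
  rw [← h0, ← h1]
  exact hloc.apply_eq_of_isPreconnected isPreconnected_univ (mem_univ _) (mem_univ _)

theorem bijective (h : IsUniformlyLocallyInvertible f K r ρ) (hf : Continuous f) :
    Function.Bijective f :=
  ⟨h.injective hf, h.surjective⟩

/-- The homeomorphism defined by a continuous uniformly locally invertible map. -/
noncomputable def homeomorph (h : IsUniformlyLocallyInvertible f K r ρ) (hf : Continuous f) :
    E ≃ₜ F where
  toEquiv := Equiv.ofBijective f (h.bijective hf)
  continuous_toFun := hf
  continuous_invFun := by
    refine continuous_iff_continuousAt.2 fun y => ?_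
    set e := Equiv.ofBijective f (h.bijective hf) with he
    obtain ⟨x, rfl⟩ := e.surjective y
    change ContinuousAt e.symm (e x)
    -- Lifting the inclusion of a ball, viewed as close to a constant map, yields a continuous local
    -- inverse, which agrees with `e.symm` by injectivity.
    obtain ⟨c', hc', hfc', -⟩ := h.exists_lift (X := closedBall (f x) ρ) (c := fun _ => x)
      continuous_const continuous_subtype_val (fun s => mem_closedBall_iff_norm.1 s.2)
    have : ContinuousOn e.symm (closedBall (f x) ρ) := by
      rw [continuousOn_iff_continuous_domRestrict]
      convert hc' using 1
      funext s
      exact e.symm_apply_eq.2 (hfc' s).symm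
    exact this.continuousAt (closedBall_mem_nhds _ h.rho_pos)

end IsUniformlyLocallyInvertible

variable [NormedSpace ℝ E] [NormedSpace ℝ F]

/-- A differentiable map whose derivative is Lipschitz and has uniformly bounded inverses is
invertible on balls of a uniform size. -/
theorem exists_isUniformlyLocallyInvertible [CompleteSpace E] {f : E → F} {f' : E → E ≃L[ℝ] F}
    {K M : ℝ} (hK : 0 < K) (hM : 0 < M) (hf : ∀ x, HasFDerivAt f (f' x : E →L[ℝ] F) x)
    (hbelow : ∀ x v, ‖v‖ ≤ K * ‖f' x v‖)
    (hlip : ∀ x y, ‖(f' x : E →L[ℝ] F) - f' y‖ ≤ M * ‖x - y‖) :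
    ∃ K' r ρ, IsUniformlyLocallyInvertible f K' r ρ := by
  -- On a ball of radius `2 * r` the derivative varies by at most `M * (2 * r) = 1 / (2 * K) = c`,
  -- half of the lower bound `1 / K` for the derivative. Absorbing this half doubles the constant to
  -- `2 * K`.
  set r : ℝ := 1 / (4 * K * M) with hr
  have hr0 : 0 < r := by positivity
  set c : ℝ := 1 / (2 * K) with hc
  have hc0 : 0 < c := by positivity
  have happrox : ∀ x, ∀ u ∈ closedBall x (2 * r), ∀ v ∈ closedBall x (2 * r),
      ‖f u - f v - f' x (u - v)‖ ≤ c * ‖u - v‖ := by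
    intro x u hu v hv
    refine Convex.norm_image_sub_le_of_norm_hasFDerivWithin_le' (φ := (f' x : E →L[ℝ] F))
      (fun z _ => (hf z).hasFDerivWithinAt) (fun z hz => ?_) (convex_closedBall x (2 * r)) hv hu
    refine (hlip z x).trans ?_
    calc M * ‖z - x‖ ≤ M * (2 * r) := by
          gcongr
          exact mem_closedBall_iff_norm.1 hz
      _ = c := by rw [hr, hc]; field_simp; norm_num
  refine ⟨2 * K, r, c * r, by positivity, hr0, by positivity, fun x u hu v hv => ?_, fun x => ?_⟩
  · have h1 := happrox x u hu v hv
    have h2 := hbelow x (u - v)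
    have h3 : ‖f' x (u - v)‖ ≤ ‖f u - f v‖ + c * ‖u - v‖ := by
      have := norm_sub_norm_le (f' x (u - v)) (f u - f v)
      rw [norm_sub_rev (f' x (u - v))] at this
      linarith
    have h4 : K * c = 1 / 2 := by rw [hc]; field_simp
    have h5 : K * ‖f' x (u - v)‖ ≤ K * (‖f u - f v‖ + c * ‖u - v‖) := by gcongr
    have h6 : K * (‖f u - f v‖ + c * ‖u - v‖) = K * ‖f u - f v‖ + 1 / 2 * ‖u - v‖ := by
      rw [← h4]; ring
    linarith
  · let S : (f' x : E →L[ℝ] F).NonlinearRightInverse :=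
      { toFun := (f' x).symm
        nnnorm := ⟨K, hK.le⟩
        bound' := fun y => by
          have := hbelow x ((f' x).symm y)
          rwa [ContinuousLinearEquiv.apply_symm_apply] at this
        right_inv' := fun y => by simp }
    have hA : ApproximatesLinearOn f (f' x : E →L[ℝ] F) (closedBall x (2 * r)) ⟨c, hc0.le⟩ :=
      fun u hu v hv => happrox x u hu v hv
    have := hA.surjOn_closedBall_of_nonlinearRightInverse S hr0.le (b := x)
      (closedBall_subset_closedBall (by linarith))
    convert this using 2
    -- The image radius for a `c`-approximate linearization with right inverse of norm `K`; the two
    -- sides agree since `c = 1 / (2 * K)`.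
    change c * r = (K⁻¹ - c) * r
    rw [hc]
    field_simp
    norm_num

/-- **Global inverse function theorem**: a smooth map whose derivative is Lipschitz and has
uniformly bounded inverses is a smooth diffeomorphism with Lipschitz inverse. -/
theorem exists_homeomorph_contDiff_symm [CompleteSpace E] {f : E → F} {f' : E → E ≃L[ℝ] F}
    {K M : ℝ} (hK : 0 < K) (hM : 0 < M) (hf : ∀ x, HasFDerivAt f (f' x : E →L[ℝ] F) x)
    (hbelow : ∀ x v, ‖v‖ ≤ K * ‖f' x v‖)
    (hlip : ∀ x y, ‖(f' x : E →L[ℝ] F) - f' y‖ ≤ M * ‖x - y‖) (hsmooth : ContDiff ℝ ∞ f) :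
    ∃ e : E ≃ₜ F, (∀ x, e x = f x) ∧ ContDiff ℝ ∞ e.symm ∧
      (∀ y, HasFDerivAt e.symm ((f' (e.symm y)).symm : F →L[ℝ] E) y) ∧
      LipschitzWith ⟨K, hK.le⟩ e.symm := by
  obtain ⟨K', r, ρ, h⟩ := exists_isUniformlyLocallyInvertible hK hM hf hbelow hlip
  set e := h.homeomorph hsmooth.continuous with he
  have hderiv : ∀ y, HasFDerivAt e.symm ((f' (e.symm y)).symm : F →L[ℝ] E) y := fun y =>
    HasFDerivAt.of_local_left_inverse e.symm.continuous.continuousAt (hf _)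
      (Filter.Eventually.of_forall fun z => e.apply_symm_apply z)
  refine ⟨e, fun _ => rfl, e.contDiff_symm hf hsmooth, hderiv, ?_⟩
  refine lipschitzWith_of_nnnorm_fderiv_le (𝕜 := ℝ) (fun y => (hderiv y).differentiableAt)
    fun y => ?_
  rw [(hderiv y).fderiv]
  refine ContinuousLinearMap.opNorm_le_bound _ hK.le fun v => ?_
  simpa using hbelow (e.symm y) ((f' (e.symm y)).symm v)

end GlobalInverse

/-! ### The canonical transformation generated by a phase function -/

namespace FourierOp

variable {d : ℕ}

/-- The Riesz representative of the restriction `ℓ ∘ L` of a linear form `ℓ` on phase space. -/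
noncomputable def rieszComp (L : Eu d →L[ℝ] Phase d) : (Phase d →L[ℝ] ℝ) →L[ℝ] Eu d :=
  LinearMap.toContinuousLinearMap
    { toFun := fun ℓ => (InnerProductSpace.toDual ℝ (Eu d)).symm (ℓ.comp L)
      map_add' := fun ℓ ℓ' => by simp [ContinuousLinearMap.add_comp]
      map_smul' := fun c ℓ => by simp [ContinuousLinearMap.smul_comp] }

theorem rieszComp_apply (L : Eu d →L[ℝ] Phase d) (ℓ : Phase d →L[ℝ] ℝ) :
    rieszComp L ℓ = (InnerProductSpace.toDual ℝ (Eu d)).symm (ℓ.comp L) :=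
  rfl

theorem inner_rieszComp_left (L : Eu d →L[ℝ] Phase d) (ℓ : Phase d →L[ℝ] ℝ) (v : Eu d) :
    inner ℝ (rieszComp L ℓ) v = ℓ (L v) := by
  rw [rieszComp_apply, InnerProductSpace.toDual_symm_apply]
  rfl

theorem inner_rieszComp_right (L : Eu d →L[ℝ] Phase d) (ℓ : Phase d →L[ℝ] ℝ) (v : Eu d) :
    inner ℝ v (rieszComp L ℓ) = ℓ (L v) := by
  rw [real_inner_comm, inner_rieszComp_left]

theorem norm_rieszComp_le (L : Eu d →L[ℝ] Phase d) (ℓ : Phase d →L[ℝ] ℝ) :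
    ‖rieszComp L ℓ‖ ≤ ‖ℓ‖ * ‖L‖ := by
  rw [rieszComp_apply, LinearIsometryEquiv.norm_map]
  exact ℓ.opNorm_comp_le L

theorem gradX_eq_rieszComp {Φ : Phase d → ℝ} (hΦ : Differentiable ℝ Φ) (x η : Eu d) :
    gradX Φ x η = rieszComp (.inl ℝ (Eu d) (Eu d)) (fderiv ℝ Φ (x, η)) := by
  rw [gradX, gradient, rieszComp_apply]
  congr 1
  exact ((hΦ (x, η)).hasFDerivAt.comp x (hasFDerivAt_prodMk_left x η)).fderiv

theorem gradEta_eq_rieszComp {Φ : Phase d → ℝ} (hΦ : Differentiable ℝ Φ) (x η : Eu d) :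
    gradEta Φ x η = rieszComp (.inr ℝ (Eu d) (Eu d)) (fderiv ℝ Φ (x, η)) := by
  rw [gradEta, gradient, rieszComp_apply]
  congr 1
  exact ((hΦ (x, η)).hasFDerivAt.comp η (hasFDerivAt_prodMk_right x η)).fderiv

/-- The second derivative of `Φ` as a bilinear form. -/
noncomputable abbrev hess (Φ : Phase d → ℝ) (z : Phase d) : Phase d →L[ℝ] Phase d →L[ℝ] ℝ :=
  fderiv ℝ (fderiv ℝ Φ) z

namespace IsPhase

variable {Φ : Phase d → ℝ}

theorem differentiable (hΦ : IsPhase Φ) : Differentiable ℝ Φ :=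
  hΦ.smooth.differentiable (by simp)

theorem contDiff_fderiv (hΦ : IsPhase Φ) : ContDiff ℝ ∞ (fderiv ℝ Φ) :=
  hΦ.smooth.fderiv_right (by simp)

theorem hasFDerivAt_fderiv (hΦ : IsPhase Φ) (z : Phase d) :
    HasFDerivAt (fderiv ℝ Φ) (hess Φ z) z :=
  (hΦ.contDiff_fderiv.differentiable (by simp) z).hasFDerivAt

theorem exists_norm_hess_le (hΦ : IsPhase Φ) : ∃ C, 0 < C ∧ ∀ z, ‖hess Φ z‖ ≤ C := by
  obtain ⟨C, hC⟩ := hΦ.bounded 2 le_rfl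
  refine ⟨max C 1, by positivity, fun z => le_max_of_le_left ?_⟩
  refine le_trans (le_of_eq ?_) (hC z)
  rw [← norm_iteratedFDeriv_fderiv, norm_iteratedFDeriv_one]

theorem exists_norm_hess_sub_le (hΦ : IsPhase Φ) :
    ∃ C, 0 < C ∧ ∀ z w, ‖hess Φ z - hess Φ w‖ ≤ C * ‖z - w‖ := by
  obtain ⟨C, hC⟩ := hΦ.bounded 3 (by norm_num)
  refine ⟨max C 1, by positivity, fun z w => ?_⟩
  have hd : Differentiable ℝ (hess Φ) :=
    (hΦ.contDiff_fderiv.fderiv_right (m := ∞) (by simp)).differentiable (by simp)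
  refine Convex.norm_image_sub_le_of_norm_fderiv_le (𝕜 := ℝ) (s := Set.univ) (f := hess Φ)
    (fun y _ => hd y)
    (fun y _ => le_max_of_le_left (le_trans (le_of_eq ?_) (hC y))) convex_univ
    (Set.mem_univ w) (Set.mem_univ z)
  rw [← norm_iteratedFDeriv_fderiv, ← norm_iteratedFDeriv_fderiv, norm_iteratedFDeriv_one]

theorem hess_comm (hΦ : IsPhase Φ) (z u v : Phase d) : hess Φ z u v = hess Φ z v u :=
  ((contDiff_infty.1 hΦ.smooth 2).contDiffAt.isSymmSndFDerivAt (by simp)).eq u v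

theorem mixedHessian_apply (hΦ : IsPhase Φ) (z : Phase d) (i j : Fin d) :
    mixedHessian Φ z i j = hess Φ z (stdVec i, 0) (0, stdVec j) := by
  have h := (hΦ.hasFDerivAt_fderiv z).clm_apply (hasFDerivAt_const (phaseVec (Sum.inr j)) z)
  rw [mixedHessian, Matrix.of_apply, h.fderiv]
  simp [phaseVec]

end IsPhase

/-! ### Quantitative invertibility of the mixed Hessian. -/

theorem norm_stdVec (i : Fin d) : ‖stdVec i‖ = 1 := by
  simp [stdVec]

theorem sum_smul_stdVec (u : Eu d) : ∑ i, u i • stdVec i = u := by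
  ext j
  simp [stdVec, Finset.sum_apply, Pi.single_apply]

theorem inner_stdVec_right (u : Eu d) (i : Fin d) : inner ℝ u (stdVec i) = u i := by
  simp [stdVec, EuclideanSpace.inner_single_right]

theorem abs_apply_le_norm (u : Eu d) (i : Fin d) : |u i| ≤ ‖u‖ :=
  PiLp.norm_apply_le u i

theorem norm_le_sum_abs (u : Eu d) : ‖u‖ ≤ ∑ i, |u i| := by
  conv_lhs => rw [← sum_smul_stdVec u]
  refine (norm_sum_le _ _).trans (Finset.sum_le_sum fun i _ => ?_)
  rw [norm_smul, norm_stdVec, mul_one, Real.norm_eq_abs]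

/-- An adjugate entry is the determinant of `A` with one row replaced by a basis vector; `1 ≤ c`
covers the entries of that row. -/
theorem abs_adjugate_le {ι : Type*} [Fintype ι] [DecidableEq ι] {A : Matrix ι ι ℝ} {c : ℝ}
    (hc : 1 ≤ c) (hA : ∀ i j, |A i j| ≤ c) (i j : ι) :
    |A.adjugate i j| ≤ (Fintype.card ι).factorial * c ^ Fintype.card ι := by
  rw [Matrix.adjugate_apply, ← nsmul_eq_mul]
  refine Matrix.det_le (abv := AbsoluteValue.abs) fun k l => ?_
  rw [AbsoluteValue.abs_apply, Matrix.updateRow_apply]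
  split_ifs
  · rw [Pi.single_apply]
    split_ifs
    · simpa using hc
    · simpa using zero_le_one.trans hc
  · exact hA k l

/-- The uniform invertibility of the mixed Hessian. -/
theorem IsPhase.exists_norm_le_rieszComp_hess {Φ : Phase d → ℝ} (hΦ : IsPhase Φ) :
    ∃ K, 0 < K ∧ ∀ z u, ‖u‖ ≤ K * ‖rieszComp (.inr ℝ (Eu d) (Eu d)) (hess Φ z (u, 0))‖ := by
  obtain ⟨C, hC0, hC⟩ := hΦ.exists_norm_hess_le
  obtain ⟨δ, hδ, hdet⟩ := hΦ.nondegenerate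
  set c := max C 1
  set A : ℝ := (Fintype.card (Fin d)).factorial * c ^ Fintype.card (Fin d) with hA
  have hA0 : 0 ≤ A := by positivity
  refine ⟨d * (d * A) / δ + 1, by positivity, fun z u => ?_⟩
  set w := rieszComp (.inr ℝ (Eu d) (Eu d)) (hess Φ z (u, 0)) with hw
  set H := mixedHessian Φ z with hH
  have hent : ∀ i j, |H i j| ≤ c := fun i j => by
    rw [hH, hΦ.mixedHessian_apply]
    calc |hess Φ z (stdVec i, 0) (0, stdVec j)|
        ≤ ‖hess Φ z‖ * ‖((stdVec i, 0) : Phase d)‖ * ‖((0, stdVec j) : Phase d)‖ :=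
          (hess Φ z).le_opNorm₂ _ _
      _ = ‖hess Φ z‖ := by simp [Prod.norm_def, norm_stdVec]
      _ ≤ c := (hC z).trans (le_max_left _ _)
  have hwH : Matrix.vecMul (⇑u) H = ⇑w := by
    funext j
    rw [← inner_stdVec_right w j, hw, inner_rieszComp_left]
    have hu : ((u, 0) : Phase d) = ∑ i, u i • ((stdVec i, 0) : Phase d) := by
      conv_lhs => rw [← sum_smul_stdVec u]
      ext <;> simp [Prod.fst_sum, Prod.snd_sum]
    rw [hu, map_sum, sum_apply, Matrix.vecMul, dotProduct]
    refine Finset.sum_congr rfl fun i _ => ?_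
    rw [hH, hΦ.mixedHessian_apply, map_smul]
    rfl
  -- Cramer's rule: `u H = w` multiplied by the adjugate, so that only the lower bound on the
  -- determinant is needed to recover `u`.
  have hdu : ∀ i, H.det * u i = ∑ j, w j * H.adjugate j i := fun i => by
    have := congrArg (fun v => Matrix.vecMul v H.adjugate i) hwH
    simp only [Matrix.vecMul_vecMul, Matrix.mul_adjugate, Matrix.vecMul_smul,
      Matrix.vecMul_one] at this
    simpa [Matrix.vecMul, dotProduct] using this
  have hui : ∀ i, |u i| ≤ d * A / δ * ‖w‖ := fun i => by
    have h1 : |H.det * u i| ≤ d * (‖w‖ * A) := by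
      rw [hdu]
      refine (Finset.abs_sum_le_sum_abs _ _).trans ?_
      refine (Finset.sum_le_sum (g := fun _ => ‖w‖ * A) fun j _ => ?_).trans (by simp)
      rw [abs_mul]
      gcongr
      · exact abs_apply_le_norm w j
      · exact abs_adjugate_le (le_max_right _ _) hent j i
    rw [abs_mul] at h1
    have h2 : δ * |u i| ≤ d * (‖w‖ * A) :=
      (mul_le_mul_of_nonneg_right (hdet z) (abs_nonneg _)).trans h1
    calc |u i| = δ * |u i| / δ := by field_simp
      _ ≤ d * (‖w‖ * A) / δ := by gcongr
      _ = d * A / δ * ‖w‖ := by ring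
  calc ‖u‖ ≤ ∑ i, |u i| := norm_le_sum_abs u
    _ ≤ ∑ _i : Fin d, d * A / δ * ‖w‖ := Finset.sum_le_sum fun i _ => hui i
    _ = d * (d * A) / δ * ‖w‖ := by simp; ring
    _ ≤ (d * (d * A) / δ + 1) * ‖w‖ := by gcongr; linarith

/-! ### The two generating maps and the canonical transformation. -/

/-- The map `(x, η) ↦ (∇_η Φ (x, η), η)`. -/
noncomputable def etaMap (Φ : Phase d → ℝ) (z : Phase d) : Phase d :=
  (rieszComp (.inr ℝ (Eu d) (Eu d)) (fderiv ℝ Φ z), z.2)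

/-- The map `(x, η) ↦ (x, ∇_x Φ (x, η))`. -/
noncomputable def xMap (Φ : Phase d → ℝ) (z : Phase d) : Phase d :=
  (z.1, rieszComp (.inl ℝ (Eu d) (Eu d)) (fderiv ℝ Φ z))

/-- The derivative of `etaMap`. -/
noncomputable def etaMapDeriv (Φ : Phase d → ℝ) (z : Phase d) : Phase d →L[ℝ] Phase d :=
  ((rieszComp (.inr ℝ (Eu d) (Eu d))).comp (hess Φ z)).prod (.snd ℝ (Eu d) (Eu d))

/-- The derivative of `xMap`. -/
noncomputable def xMapDeriv (Φ : Phase d → ℝ) (z : Phase d) : Phase d →L[ℝ] Phase d :=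
  (ContinuousLinearMap.fst ℝ (Eu d) (Eu d)).prod
    ((rieszComp (.inl ℝ (Eu d) (Eu d))).comp (hess Φ z))

theorem norm_inl_le : ‖ContinuousLinearMap.inl ℝ (Eu d) (Eu d)‖ ≤ 1 :=
  ContinuousLinearMap.norm_inl_le_one ℝ (Eu d) (Eu d)

theorem norm_inr_le : ‖ContinuousLinearMap.inr ℝ (Eu d) (Eu d)‖ ≤ 1 :=
  ContinuousLinearMap.norm_inr_le_one ℝ (Eu d) (Eu d)

theorem norm_rieszComp_apply_le {L : Eu d →L[ℝ] Phase d} (hL : ‖L‖ ≤ 1) (ℓ : Phase d →L[ℝ] ℝ) :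
    ‖rieszComp L ℓ‖ ≤ ‖ℓ‖ :=
  (norm_rieszComp_le L ℓ).trans (mul_le_of_le_one_right (norm_nonneg _) hL)

namespace IsPhase

variable {Φ : Phase d → ℝ}

theorem contDiff_etaMap (hΦ : IsPhase Φ) : ContDiff ℝ ∞ (etaMap Φ) :=
  ((rieszComp _).contDiff.comp hΦ.contDiff_fderiv).prodMk contDiff_snd

theorem contDiff_xMap (hΦ : IsPhase Φ) : ContDiff ℝ ∞ (xMap Φ) :=
  contDiff_fst.prodMk ((rieszComp _).contDiff.comp hΦ.contDiff_fderiv)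

theorem hasFDerivAt_etaMap (hΦ : IsPhase Φ) (z : Phase d) :
    HasFDerivAt (etaMap Φ) (etaMapDeriv Φ z) z :=
  ((rieszComp _).hasFDerivAt.comp z (hΦ.hasFDerivAt_fderiv z)).prodMk hasFDerivAt_snd

theorem hasFDerivAt_xMap (hΦ : IsPhase Φ) (z : Phase d) :
    HasFDerivAt (xMap Φ) (xMapDeriv Φ z) z :=
  hasFDerivAt_fst.prodMk ((rieszComp _).hasFDerivAt.comp z (hΦ.hasFDerivAt_fderiv z))

/-- Block triangularity: the second component gives `v.2` directly, and after the Hessian's action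
on `(0, v.2)` is subtracted, the mixed block gives `v.1`. -/
theorem exists_norm_le_etaMapDeriv (hΦ : IsPhase Φ) :
    ∃ K, 0 < K ∧ ∀ z v, ‖v‖ ≤ K * ‖etaMapDeriv Φ z v‖ := by
  obtain ⟨C, hC0, hC⟩ := hΦ.exists_norm_hess_le
  obtain ⟨K, hK0, hK⟩ := hΦ.exists_norm_le_rieszComp_hess
  refine ⟨K * (1 + C) + 1, by positivity, fun z v => ?_⟩
  set R := rieszComp (.inr ℝ (Eu d) (Eu d)) with hR
  set M := ‖etaMapDeriv Φ z v‖ with hM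
  have h1 : ‖R (hess Φ z v)‖ ≤ M := norm_fst_le (etaMapDeriv Φ z v)
  have h2 : ‖v.2‖ ≤ M := norm_snd_le (etaMapDeriv Φ z v)
  have h3 : ‖R (hess Φ z (0, v.2))‖ ≤ C * M := by
    refine (norm_rieszComp_apply_le norm_inr_le _).trans ?_
    refine ((hess Φ z).le_of_opNorm_le (hC z) _).trans ?_
    have : ‖((0, v.2) : Phase d)‖ = ‖v.2‖ := by simp [Prod.norm_def]
    rw [this]
    gcongr
  have h4 : R (hess Φ z (v.1, 0)) = R (hess Φ z v) - R (hess Φ z (0, v.2)) := by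
    rw [← map_sub, ← map_sub]
    congr 2
    ext <;> simp
  have h5 : ‖v.1‖ ≤ K * (1 + C) * M := by
    refine (hK z v.1).trans ?_
    rw [h4, mul_assoc]
    gcongr
    refine (norm_sub_le _ _).trans ?_
    linarith
  have hM0 : 0 ≤ M := norm_nonneg _
  have h6 : 0 ≤ K * (1 + C) * M := by positivity
  exact max_le (by linarith) (by linarith)

theorem exists_norm_etaMapDeriv_sub_le (hΦ : IsPhase Φ) :
    ∃ M, 0 < M ∧ ∀ z w, ‖etaMapDeriv Φ z - etaMapDeriv Φ w‖ ≤ M * ‖z - w‖ := by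
  obtain ⟨M, hM0, hM⟩ := hΦ.exists_norm_hess_sub_le
  refine ⟨M, hM0, fun z w => ContinuousLinearMap.opNorm_le_bound _ (by positivity) fun v => ?_⟩
  refine max_le ?_ ?_
  · change ‖rieszComp (.inr ℝ (Eu d) (Eu d)) (hess Φ z v) -
      rieszComp (.inr ℝ (Eu d) (Eu d)) (hess Φ w v)‖ ≤ _
    rw [← map_sub]
    exact (norm_rieszComp_apply_le norm_inr_le _).trans
      ((hess Φ z - hess Φ w).le_of_opNorm_le (hM z w) v)
  · change ‖v.2 - v.2‖ ≤ _
    rw [sub_self, norm_zero]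
    positivity

theorem exists_lipschitzWith_etaMap (hΦ : IsPhase Φ) : ∃ K, LipschitzWith K (etaMap Φ) := by
  obtain ⟨C, hC0, hC⟩ := hΦ.exists_norm_hess_le
  refine ⟨⟨max C 1, by positivity⟩, lipschitzWith_of_nnnorm_fderiv_le (𝕜 := ℝ)
    (fun z => (hΦ.hasFDerivAt_etaMap z).differentiableAt) fun z => ?_⟩
  rw [(hΦ.hasFDerivAt_etaMap z).fderiv]
  refine ContinuousLinearMap.opNorm_le_bound _ (by positivity) fun v => max_le ?_ ?_
  · exact (norm_rieszComp_apply_le norm_inr_le _).trans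
      ((hess Φ z).le_of_opNorm_le ((hC z).trans (le_max_left _ _)) v)
  · exact (norm_snd_le v).trans (le_mul_of_one_le_left (norm_nonneg _) (le_max_right _ _))

theorem exists_etaMap_homeomorph (hΦ : IsPhase Φ) :
    ∃ e : Phase d ≃ₜ Phase d, (∀ z, e z = etaMap Φ z) ∧ ContDiff ℝ ∞ e.symm ∧
      ∃ K, LipschitzWith K e.symm := by
  obtain ⟨K, hK0, hK⟩ := hΦ.exists_norm_le_etaMapDeriv
  obtain ⟨M, hM0, hM⟩ := hΦ.exists_norm_etaMapDeriv_sub_le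
  have hequiv : ∀ z, ∃ L : Phase d ≃L[ℝ] Phase d, (L : Phase d →L[ℝ] Phase d) =
      etaMapDeriv Φ z := fun z => by
    have hinj : Function.Injective (etaMapDeriv Φ z : Phase d →ₗ[ℝ] Phase d) := by
      rw [injective_iff_map_eq_zero]
      intro v hv
      have := hK z v
      rw [show etaMapDeriv Φ z v = 0 from hv, norm_zero, mul_zero] at this
      exact norm_le_zero_iff.1 this
    exact ⟨(LinearEquiv.ofInjectiveEndo _ hinj).toContinuousLinearEquiv, by ext v <;> rfl⟩
  choose L hL using hequiv
  have hLv : ∀ z v, L z v = etaMapDeriv Φ z v := fun z v => by rw [← hL]; rfl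
  obtain ⟨e, he, hsymm, -, hlip⟩ := exists_homeomorph_contDiff_symm (f' := L) hK0 hM0
    (fun z => by rw [hL]; exact hΦ.hasFDerivAt_etaMap z) (fun z v => by rw [hLv]; exact hK z v)
    (fun z w => by rw [hL, hL]; exact hM z w) hΦ.contDiff_etaMap
  exact ⟨e, he, hsymm, _, hlip⟩

/-- Exchanging the variables transposes the mixed Hessian, so results for `etaMap` transfer to
`xMap`. -/
theorem comp_swap (hΦ : IsPhase Φ) : IsPhase (Φ ∘ Prod.swap) where
  smooth := hΦ.smooth.comp (contDiff_snd.prodMk contDiff_fst)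
  bounded k hk := by
    obtain ⟨C, hC⟩ := hΦ.bounded k hk
    refine ⟨C, fun z => ?_⟩
    have := (LinearIsometryEquiv.prodComm ℝ (Eu d) (Eu d)).norm_iteratedFDeriv_comp_right
      (𝕜 := ℝ) Φ z k
    exact this.le.trans (hC _)
  nondegenerate := by
    obtain ⟨δ, hδ, h⟩ := hΦ.nondegenerate
    refine ⟨δ, hδ, fun z => ?_⟩
    have : mixedHessian (Φ ∘ Prod.swap) z = (mixedHessian Φ z.swap).transpose := by
      ext i j
      rw [Matrix.transpose_apply, hΦ.mixedHessian_apply, hΦ.hess_comm, mixedHessian,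
        Matrix.of_apply]
      have hswap : ∀ w : Phase d, HasFDerivAt Prod.swap
          ((ContinuousLinearMap.snd ℝ (Eu d) (Eu d)).prod (.fst ℝ (Eu d) (Eu d))) w := fun w =>
        hasFDerivAt_snd.prodMk hasFDerivAt_fst
      have h1 : (fun w : Phase d => fderiv ℝ (Φ ∘ Prod.swap) w (phaseVec (Sum.inr j))) =
          fun w => fderiv ℝ Φ w.swap (stdVec j, 0) := by
        funext w
        rw [((hΦ.differentiable w.swap).hasFDerivAt.comp w (hswap w)).fderiv]
        rfl
      have h2 := ((hΦ.hasFDerivAt_fderiv z.swap).comp z (hswap z)).clm_apply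
        (hasFDerivAt_const ((stdVec j, 0) : Phase d) z)
      simp only [Function.comp_apply] at h2
      rw [h1, h2.fderiv]
      simp [phaseVec]
    rw [this, Matrix.det_transpose]
    exact h _

theorem xMap_eq_swap_etaMap (hΦ : IsPhase Φ) (z : Phase d) :
    xMap Φ z = (etaMap (Φ ∘ Prod.swap) z.swap).swap := by
  refine Prod.ext rfl ?_
  change rieszComp _ (fderiv ℝ Φ (z.1, z.2)) =
    rieszComp _ (fderiv ℝ (Φ ∘ Prod.swap) (z.2, z.1))
  rw [← gradX_eq_rieszComp hΦ.differentiable, ← gradEta_eq_rieszComp hΦ.comp_swap.differentiable]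
  rfl

theorem exists_xMap_homeomorph (hΦ : IsPhase Φ) :
    ∃ e : Phase d ≃ₜ Phase d, (∀ z, e z = xMap Φ z) ∧ ContDiff ℝ ∞ e.symm ∧
      ∃ K, LipschitzWith K e.symm := by
  obtain ⟨e, he, hsymm, K, hlip⟩ := hΦ.comp_swap.exists_etaMap_homeomorph
  set S : Phase d ≃ₗᵢ[ℝ] Phase d := LinearIsometryEquiv.prodComm ℝ (Eu d) (Eu d)
  refine ⟨(S.toHomeomorph.trans e).trans S.toHomeomorph, fun z => ?_,
    S.contDiff.comp (hsymm.comp S.contDiff), 1 * (K * 1),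
    S.lipschitz.comp (hlip.comp S.lipschitz)⟩
  rw [hΦ.xMap_eq_swap_etaMap, ← he]
  rfl

theorem exists_lipschitzWith_xMap (hΦ : IsPhase Φ) : ∃ K, LipschitzWith K (xMap Φ) := by
  obtain ⟨C, hC0, hC⟩ := hΦ.exists_norm_hess_le
  refine ⟨⟨max C 1, by positivity⟩, lipschitzWith_of_nnnorm_fderiv_le (𝕜 := ℝ)
    (fun z => (hΦ.hasFDerivAt_xMap z).differentiableAt) fun z => ?_⟩
  rw [(hΦ.hasFDerivAt_xMap z).fderiv]
  refine ContinuousLinearMap.opNorm_le_bound _ (by positivity) fun v => max_le ?_ ?_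
  · exact (norm_fst_le v).trans (le_mul_of_one_le_left (norm_nonneg _) (le_max_right _ _))
  · exact (norm_rieszComp_apply_le norm_inl_le _).trans
      ((hess Φ z).le_of_opNorm_le ((hC z).trans (le_max_left _ _)) v)

/-- This is d(dΦ) = 0 in coordinates. By symmetry of the Hessian its pure xx and ηη blocks cancel,
and both sides reduce to the same expression in the mixed block. -/
theorem symplecticForm_xMapDeriv (hΦ : IsPhase Φ) (z u v : Phase d) :
    symplecticForm (xMapDeriv Φ z u) (xMapDeriv Φ z v) =
      symplecticForm (etaMapDeriv Φ z u) (etaMapDeriv Φ z v) := by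
  have hsplit : ∀ w : Phase d, w = (w.1, 0) + (0, w.2) := fun w => by simp
  have hb : ∀ p q : Phase d, hess Φ z p q =
      hess Φ z (p.1, 0) q + hess Φ z (0, p.2) q := fun p q => by
    rw [← add_apply, ← map_add, ← hsplit]
  simp only [symplecticForm, xMapDeriv, etaMapDeriv, ContinuousLinearMap.prod_apply,
    ContinuousLinearMap.comp_apply, ContinuousLinearMap.coe_fst', ContinuousLinearMap.coe_snd',
    inner_rieszComp_left, inner_rieszComp_right, ContinuousLinearMap.inl_apply,
    ContinuousLinearMap.inr_apply]
  rw [hb v (u.1, 0), hb u (v.1, 0), hb u (0, v.2), hb v (0, u.2),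
    hΦ.hess_comm z (v.1, 0) (u.1, 0), hΦ.hess_comm z (u.1, 0) (0, v.2),
    hΦ.hess_comm z (v.1, 0) (0, u.2), hΦ.hess_comm z (0, v.2) (0, u.2)]
  ring

/-- A phase function generates a canonical transformation `χ`, and the distance of `χ (m, n)` to
`(m', n')` is controlled by the defect of `(m', n')` in the generating equations. -/
theorem exists_canonicalTransformation (hΦ : IsPhase Φ) :
    ∃ χ : Phase d ≃ Phase d, IsCanonicalTransformation χ ∧ IsGeneratedBy Φ χ ∧
      ∃ K, 0 < K ∧ ∀ m n m' n' : Eu d, ‖χ (m, n) - (m', n')‖ ≤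
        K * (‖gradX Φ m' n - n'‖ + ‖gradEta Φ m' n - m‖) := by
  obtain ⟨e, he, hsymm, K, hlip⟩ := hΦ.exists_etaMap_homeomorph
  obtain ⟨e', he', hsymm', K', hlip'⟩ := hΦ.exists_xMap_homeomorph
  obtain ⟨M, hM⟩ := hΦ.exists_lipschitzWith_etaMap
  obtain ⟨M', hM'⟩ := hΦ.exists_lipschitzWith_xMap
  have hχ : ⇑(e.symm.toEquiv.trans e'.toEquiv) = xMap Φ ∘ e.symm := funext fun p => he' _
  have hχs : ⇑(e.symm.toEquiv.trans e'.toEquiv).symm = etaMap Φ ∘ e'.symm := funext fun p => he _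
  have heta : ∀ x η, etaMap Φ (x, η) = (gradEta Φ x η, η) := fun x η => by
    rw [gradEta_eq_rieszComp hΦ.differentiable]; rfl
  have hx : ∀ x η, xMap Φ (x, η) = (x, gradX Φ x η) := fun x η => by
    rw [gradX_eq_rieszComp hΦ.differentiable]; rfl
  refine ⟨e.symm.toEquiv.trans e'.toEquiv, ⟨?_, ?_, ⟨M' * K, ?_⟩, ⟨M * K', ?_⟩, fun p u v => ?_⟩,
    fun y η x ξ => ?_, K + M' * K + 1, by positivity, fun m n m' n' => ?_⟩
  · rw [hχ]
    exact hΦ.contDiff_xMap.comp hsymm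
  · rw [hχs]
    exact hΦ.contDiff_etaMap.comp hsymm'
  · rw [hχ]
    exact hM'.comp hlip
  · rw [hχs]
    exact hM.comp hlip'
  · have hd := (hsymm.differentiable (by simp) p).hasFDerivAt
    have hcomp : ∀ w, etaMapDeriv Φ (e.symm p) (fderiv ℝ e.symm p w) = w := fun w => by
      have h1 := (hΦ.hasFDerivAt_etaMap (e.symm p)).comp p hd
      have h2 : etaMap Φ ∘ e.symm = id := funext fun q => by
        rw [Function.comp_apply, ← he, e.apply_symm_apply, id]
      rw [h2] at h1
      exact congrArg (fun L => L w) (h1.unique (hasFDerivAt_id p))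
    rw [hχ, ((hΦ.hasFDerivAt_xMap (e.symm p)).comp p hd).fderiv]
    simp only [ContinuousLinearMap.comp_apply]
    rw [hΦ.symplecticForm_xMapDeriv, hcomp, hcomp]
  · rw [hχ, Function.comp_apply]
    constructor
    · intro h
      obtain ⟨⟨x', η'⟩, hz⟩ := e.surjective (y, η)
      rw [← hz, e.symm_apply_apply, hx] at h
      rw [he, heta] at hz
      simp only [Prod.mk.injEq] at h hz
      obtain ⟨rfl, rfl⟩ := h
      obtain ⟨rfl, rfl⟩ := hz
      exact ⟨rfl, rfl⟩
    · rintro ⟨rfl, rfl⟩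
      rw [← heta, ← he, e.symm_apply_apply, hx]
  · rw [hχ, Function.comp_apply]
    obtain ⟨⟨x, η⟩, hz⟩ := e.surjective (m, n)
    have hz' := hz
    rw [he, heta] at hz'
    simp only [Prod.mk.injEq] at hz'
    obtain ⟨rfl, rfl⟩ := hz'
    rw [← hz, e.symm_apply_apply, hx]
    set D := ‖gradEta Φ m' η - gradEta Φ x η‖ with hD
    set D' := ‖gradX Φ m' η - n'‖ with hD'
    have hD0 : 0 ≤ D := norm_nonneg _
    have hD0' : 0 ≤ D' := norm_nonneg _
    -- Here `(m, n) = e (x, η)`, so `D` is the distance between the images of `(x, η)` and `(m', η)`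
    -- under `e`. The Lipschitz inverse controls `x - m'`, and then the Lipschitz map `xMap`
    -- controls the second component.
    have h1 : ‖((x, η) : Phase d) - (m', η)‖ ≤ K * D := by
      have := hlip.norm_sub_le (e (x, η)) (e (m', η))
      rw [e.symm_apply_apply, e.symm_apply_apply, he, he, heta, heta] at this
      refine this.trans_eq ?_
      rw [hD, norm_sub_rev (gradEta Φ m' η)]
      simp [Prod.norm_def]
    have h2 : ‖x - m'‖ ≤ K * D := (norm_fst_le (((x, η) : Phase d) - (m', η))).trans h1
    have h3 : ‖gradX Φ x η - gradX Φ m' η‖ ≤ M' * (K * D) := by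
      have := hM'.norm_sub_le (x, η) (m', η)
      rw [hx, hx] at this
      exact ((norm_snd_le _).trans this).trans (by gcongr)
    have h4 : ‖gradX Φ x η - n'‖ ≤ M' * (K * D) + D' :=
      (norm_sub_le_norm_sub_add_norm_sub _ (gradX Φ m' η) _).trans (by gcongr)
    have hK0 : (0 : ℝ) ≤ K := K.2
    have hM0 : (0 : ℝ) ≤ M' := M'.2
    refine max_le (h2.trans ?_) (h4.trans ?_)
    · nlinarith [mul_nonneg hK0 hD0', mul_nonneg (mul_nonneg hM0 hK0) (add_nonneg hD0 hD0')]
    · nlinarith [mul_nonneg hK0 (add_nonneg hD0 hD0'), mul_nonneg (mul_nonneg hM0 hK0) hD0']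

end IsPhase

end FourierOp

/-! ### Integration by parts against bounded functions with bounded weak derivatives -/

theorem MeasureTheory.MemLp.exists_ae_norm_le {α : Type*} [MeasurableSpace α] {μ : Measure α}
    {f : α → ℂ} (hf : MemLp f ⊤ μ) : ∃ S : ℝ, 0 ≤ S ∧ ∀ᵐ x ∂μ, ‖f x‖ ≤ S := by
  have h := hf.2
  rw [eLpNorm_exponent_top, eLpNormEssSup_lt_top_iff_isBoundedUnder] at h
  obtain ⟨S, hS⟩ := h
  exact ⟨S, S.2, (Filter.eventually_map.1 hS).mono fun x hx => hx⟩

theorem MeasureTheory.MemLp.top_mul_integrable {α : Type*} [MeasurableSpace α] {μ : Measure α}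
    {f g : α → ℂ} (hf : MemLp f ⊤ μ) (hg : Integrable g μ) :
    Integrable (fun x => f x * g x) μ := by
  obtain ⟨S, -, hS⟩ := hf.exists_ae_norm_le
  exact hg.bdd_mul hf.1 hS

section WeakDeriv

open Filter Topology

variable {E : Type*} [NormedAddCommGroup E] [NormedSpace ℝ E]

/-- `τ` is the weak derivative of `σ` in the direction `v`. -/
def IsWeakDeriv [MeasurableSpace E] (μ : Measure E) (v : E) (σ τ : E → ℂ) : Prop :=
  ∀ φ : E → ℂ, ContDiff ℝ ∞ φ → HasCompactSupport φ →
    ∫ z, σ z * fderiv ℝ φ z v ∂μ = -∫ z, τ z * φ z ∂μ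

variable [FiniteDimensional ℝ E]

/-- There is a sequence of smooth compactly supported cutoffs, bounded by one and eventually one
near each point, with uniformly bounded derivatives. -/
theorem exists_seq_cutoff (v : E) : ∃ (χ : ℕ → E → ℂ) (B : ℝ), 0 ≤ B ∧
    (∀ n, ContDiff ℝ ∞ (χ n)) ∧ (∀ n, HasCompactSupport (χ n)) ∧ (∀ n z, ‖χ n z‖ ≤ 1) ∧
    (∀ n z, ‖fderiv ℝ (χ n) z v‖ ≤ B) ∧ ∀ z, ∀ᶠ n in atTop, ∀ᶠ y in 𝓝 z, χ n y = 1 := by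
  let f : ContDiffBump (0 : E) := ⟨1, 2, one_pos, one_lt_two⟩
  let ψ : E → ℂ := fun z => (f z : ℂ)
  have hψ : ContDiff ℝ ∞ ψ := Complex.ofRealCLM.contDiff.comp f.contDiff
  have hψc : HasCompactSupport ψ := f.hasCompactSupport.comp_left Complex.ofReal_zero
  obtain ⟨B, hB⟩ := (hψ.continuous_fderiv (by simp)).bounded_above_of_compact_support
    (hψc.fderiv ℝ)
  have hB0 : 0 ≤ B := (norm_nonneg _).trans (hB 0)
  have hpos : ∀ n : ℕ, (0 : ℝ) < ((n : ℝ) + 1)⁻¹ := fun n => by positivity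
  have hlin : ∀ n : ℕ, ∀ z : E, HasFDerivAt (fun z : E => ((n : ℝ) + 1)⁻¹ • z)
      (((n : ℝ) + 1)⁻¹ • ContinuousLinearMap.id ℝ E) z := fun n z =>
    (hasFDerivAt_id z).const_smul _
  -- Dilates of a single bump; the chain rule contributes a factor `(n + 1)⁻¹ ≤ 1`, so one bound
  -- serves all `n`.
  refine ⟨fun n z => ψ (((n : ℝ) + 1)⁻¹ • z), B * ‖v‖, by positivity, fun n => ?_, fun n => ?_,
    fun n z => ?_, fun n z => ?_, fun z => ?_⟩
  · exact hψ.comp (contDiff_const_smul _)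
  · exact hψc.comp_smul (hpos n).ne'
  · simp only [ψ, Complex.norm_real, Real.norm_of_nonneg f.nonneg]
    exact f.le_one
  · have hd := ((hψ.differentiable (by simp) (((n : ℝ) + 1)⁻¹ • z)).hasFDerivAt.comp z
      (hlin n z)).fderiv
    change ‖fderiv ℝ (ψ ∘ fun z => ((n : ℝ) + 1)⁻¹ • z) z v‖ ≤ _
    rw [hd]
    refine ((fderiv ℝ ψ _).le_of_opNorm_le (hB _) _).trans ?_
    gcongr
    change ‖((n : ℝ) + 1)⁻¹ • v‖ ≤ ‖v‖
    rw [norm_smul, Real.norm_of_nonneg (hpos n).le]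
    exact mul_le_of_le_one_left (norm_nonneg _) (inv_le_one_of_one_le₀ (by simp))
  · filter_upwards [eventually_gt_atTop ⌈‖z‖⌉₊] with n hn
    have hzn : ‖z‖ < (n : ℝ) + 1 :=
      ((Nat.le_ceil _).trans_lt (Nat.cast_lt.2 hn)).trans (lt_add_one _)
    filter_upwards [continuous_norm.continuousAt.eventually_lt continuousAt_const hzn] with y hy
    have : ((n : ℝ) + 1)⁻¹ • y ∈ Metric.closedBall (0 : E) 1 := by
      rw [mem_closedBall_zero_iff, norm_smul, Real.norm_of_nonneg (hpos n).le,
        inv_mul_le_iff₀ (by positivity), mul_one]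
      exact hy.le
    simp only [ψ, f.one_of_mem_closedBall this, Complex.ofReal_one]

variable [MeasurableSpace E] [BorelSpace E] {μ : Measure E}

/-- The weak derivative of a bounded function can be tested against smooth functions which are
integrable together with their derivative. -/
theorem IsWeakDeriv.integral_mul_fderiv {v : E} {σ τ : E → ℂ} (h : IsWeakDeriv μ v σ τ)
    (hσ : MemLp σ ⊤ μ) (hτ : MemLp τ ⊤ μ) {φ : E → ℂ} (hφ : ContDiff ℝ ∞ φ)
    (hφi : Integrable φ μ) (hφi' : Integrable (fun z => fderiv ℝ φ z v) μ) :
    ∫ z, σ z * fderiv ℝ φ z v ∂μ = -∫ z, τ z * φ z ∂μ := by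
  obtain ⟨χ, B, hB0, hχ, hχc, hχ1, hχd, hχe⟩ := exists_seq_cutoff v
  obtain ⟨S, hS0, hS⟩ := hσ.exists_ae_norm_le
  obtain ⟨T, hT0, hT⟩ := hτ.exists_ae_norm_le
  have hderiv : ∀ n z, fderiv ℝ (fun z => χ n z * φ z) z v =
      χ n z * fderiv ℝ φ z v + φ z * fderiv ℝ (χ n) z v := fun n z => by
    rw [fderiv_fun_mul ((hχ n).differentiable (by simp) z) (hφ.differentiable (by simp) z)]
    simp
  have hcont : ∀ n, Continuous fun z => fderiv ℝ (fun z => χ n z * φ z) z v := fun n =>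
    (((hχ n).mul hφ).continuous_fderiv (by simp)).clm_apply continuous_const
  -- Dominated convergence for the cut-off test functions. The term with the derivative of the
  -- cutoff vanishes in the limit because the cutoff is eventually one on a neighbourhood of each
  -- point.
  have hL : Tendsto (fun n => ∫ z, σ z * fderiv ℝ (fun z => χ n z * φ z) z v ∂μ) atTop
      (𝓝 (∫ z, σ z * fderiv ℝ φ z v ∂μ)) := by
    refine tendsto_integral_of_dominated_convergence
      (fun z => S * (‖fderiv ℝ φ z v‖ + ‖φ z‖ * B))
      (fun n => hσ.1.mul (hcont n).aestronglyMeasurable)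
      ((hφi'.norm.add (hφi.norm.mul_const B)).const_mul S) (fun n => ?_)
      (Eventually.of_forall fun z => ?_)
    · filter_upwards [hS] with z hz
      rw [norm_mul, hderiv]
      gcongr
      refine (norm_add_le _ _).trans ?_
      rw [norm_mul, norm_mul]
      gcongr
      · exact mul_le_of_le_one_left (norm_nonneg _) (hχ1 n z)
      · exact hχd n z
    · refine tendsto_const_nhds.congr' ?_
      filter_upwards [hχe z] with n hn
      have : (fun y => χ n y * φ y) =ᶠ[𝓝 z] φ := by
        filter_upwards [hn] with y hy
        rw [hy, one_mul]
      rw [this.fderiv_eq]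
  have hR : Tendsto (fun n => -∫ z, τ z * (χ n z * φ z) ∂μ) atTop
      (𝓝 (-∫ z, τ z * φ z ∂μ)) := by
    refine (tendsto_integral_of_dominated_convergence (F := fun n z => τ z * (χ n z * φ z))
      (fun z => T * ‖φ z‖)
      (fun n => hτ.1.mul ((hχ n).mul hφ).continuous.aestronglyMeasurable)
      (hφi.norm.const_mul T) (fun n => ?_) (Eventually.of_forall fun z => ?_)).neg
    · filter_upwards [hT] with z hz
      rw [norm_mul, norm_mul]
      gcongr
      exact mul_le_of_le_one_left (norm_nonneg _) (hχ1 n z)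
    · refine tendsto_const_nhds.congr' ?_
      filter_upwards [hχe z] with n hn
      rw [hn.self_of_nhds, one_mul]
  refine tendsto_nhds_unique hL (hR.congr fun n => ?_)
  exact (h _ ((hχ n).mul hφ) (hχc n).mul_right).symm

end WeakDeriv

/-! ### Oscillating exponentials -/

/-- The character `t ↦ exp (2πit)`. -/
noncomputable def osc (t : ℝ) : ℂ :=
  Complex.exp (2 * Real.pi * Complex.I * (t : ℂ))

theorem osc_add (s t : ℝ) : osc (s + t) = osc s * osc t := by
  rw [osc, osc, osc, ← Complex.exp_add]
  push_cast
  ring_nf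

theorem norm_osc (t : ℝ) : ‖osc t‖ = 1 := by
  rw [osc, Complex.norm_exp]
  simp

theorem contDiff_osc : ContDiff ℝ ∞ osc :=
  (contDiff_const.mul Complex.ofRealCLM.contDiff).cexp

theorem hasDerivAt_osc (t : ℝ) : HasDerivAt osc (2 * Real.pi * Complex.I * osc t) t := by
  have h1 : HasDerivAt (fun t : ℝ => 2 * Real.pi * Complex.I * (t : ℂ))
      (2 * Real.pi * Complex.I * 1) t := (Complex.ofRealCLM.hasDerivAt (x := t)).const_mul _
  exact h1.cexp.congr_deriv (by simp only [osc]; ring)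

theorem iteratedDeriv_osc (n : ℕ) :
    iteratedDeriv n osc = fun t => (2 * Real.pi * Complex.I) ^ n * osc t := by
  induction n with
  | zero => simp
  | succ n ih =>
    rw [iteratedDeriv_succ, ih]
    funext t
    rw [((hasDerivAt_osc t).const_mul _).deriv]
    ring

theorem norm_two_pi_I : ‖(2 * Real.pi * Complex.I : ℂ)‖ = 2 * Real.pi := by
  simp [abs_of_pos Real.pi_pos]

theorem norm_iteratedFDeriv_osc (n : ℕ) (t : ℝ) :
    ‖iteratedFDeriv ℝ n osc t‖ = (2 * Real.pi) ^ n := by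
  rw [norm_iteratedFDeriv_eq_norm_iteratedDeriv, iteratedDeriv_osc, norm_mul, norm_osc, mul_one,
    norm_pow, norm_two_pi_I]

theorem one_le_two_pi : 1 ≤ 2 * Real.pi := by linarith [Real.pi_gt_three]

/-! ### Families of functions with uniformly bounded derivatives -/

section UniformBounds

variable {ι E : Type*} [NormedAddCommGroup E] [NormedSpace ℝ E]

/-- The members of a family of smooth functions have all derivatives of order at most `K` bounded
by a uniform multiple of the weight `w`. -/
structure HasUniformBounds (K : ℕ) (w : ι → E → ℝ) (a : ι → E → ℂ) : Prop where
  smooth : ∀ p, ContDiff ℝ ∞ (a p)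
  bound : ∃ C : ℝ, 0 ≤ C ∧ ∀ k ≤ K, ∀ p z, ‖iteratedFDeriv ℝ k (a p) z‖ ≤ C * w p z

namespace HasUniformBounds

variable {K : ℕ} {w w' : ι → E → ℝ} {a b : ι → E → ℂ}

theorem of_le (h : HasUniformBounds K w a) {K' : ℕ} (hK : K' ≤ K) : HasUniformBounds K' w a := by
  obtain ⟨C, hC0, hC⟩ := h.bound
  exact ⟨h.smooth, C, hC0, fun k hk => hC k (hk.trans hK)⟩

theorem mono (h : HasUniformBounds K w a) (hw : ∀ p z, w p z ≤ w' p z) :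
    HasUniformBounds K w' a := by
  obtain ⟨C, hC0, hC⟩ := h.bound
  exact ⟨h.smooth, C, hC0, fun k hk p z =>
    (hC k hk p z).trans (mul_le_mul_of_nonneg_left (hw p z) hC0)⟩

theorem mul (ha : HasUniformBounds K w a) (hb : HasUniformBounds K w' b)
    (hw : ∀ p z, 0 ≤ w p z) (hw' : ∀ p z, 0 ≤ w' p z) :
    HasUniformBounds K (fun p z => w p z * w' p z) (fun p z => a p z * b p z) := by
  obtain ⟨C, hC0, hC⟩ := ha.bound
  obtain ⟨C', hC0', hC'⟩ := hb.bound
  refine ⟨fun p => (ha.smooth p).mul (hb.smooth p), 2 ^ K * (C * C'), by positivity,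
    fun k hk p z => ?_⟩
  refine (norm_iteratedFDeriv_mul_le (ha.smooth p) (hb.smooth p) z
    (mod_cast le_top : ((k : ℕ∞) : WithTop ℕ∞) ≤ ∞)).trans ?_
  have hww := mul_nonneg (hw p z) (hw' p z)
  calc ∑ i ∈ Finset.range (k + 1), (k.choose i : ℝ) * ‖iteratedFDeriv ℝ i (a p) z‖ *
        ‖iteratedFDeriv ℝ (k - i) (b p) z‖
      ≤ ∑ i ∈ Finset.range (k + 1), (k.choose i : ℝ) * (C * w p z) * (C' * w' p z) := by
        refine Finset.sum_le_sum fun i hi => ?_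
        have h1 := hC i ((Finset.mem_range_succ_iff.1 hi).trans hk) p z
        have h2 := hC' (k - i) ((Nat.sub_le _ _).trans hk) p z
        have h3 := (norm_nonneg _).trans h1
        gcongr
    _ = 2 ^ k * (C * C') * (w p z * w' p z) := by
        rw [← Finset.sum_mul, ← Finset.sum_mul, ← Nat.cast_sum, Nat.sum_range_choose]
        push_cast
        ring
    _ ≤ 2 ^ K * (C * C') * (w p z * w' p z) := by
        gcongr
        norm_num

theorem fderiv_apply (h : HasUniformBounds (K + 1) w a) (v : E) :
    HasUniformBounds K w (fun p z => fderiv ℝ (a p) z v) := by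
  obtain ⟨C, hC0, hC⟩ := h.bound
  have hs : ∀ p, ContDiff ℝ ∞ (fderiv ℝ (a p)) := fun p => (h.smooth p).fderiv_right (by simp)
  refine ⟨fun p => (hs p).clm_apply contDiff_const, ‖v‖ * C, by positivity, fun k hk p z => ?_⟩
  refine (norm_iteratedFDeriv_clm_apply_const (hs p).contDiffAt
    (mod_cast le_top : ((k : ℕ∞) : WithTop ℕ∞) ≤ ∞)).trans ?_
  rw [norm_iteratedFDeriv_fderiv, mul_assoc]
  gcongr
  exact hC (k + 1) (by lia) p z

theorem conj (h : HasUniformBounds K w a) :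
    HasUniformBounds K w (fun p z => (starRingEnd ℂ) (a p z)) := by
  obtain ⟨C, hC0, hC⟩ := h.bound
  refine ⟨fun p => Complex.conjCLE.contDiff.comp (h.smooth p), C, hC0, fun k hk p z => ?_⟩
  have := Complex.conjLIE.norm_iteratedFDeriv_comp_left (𝕜 := ℝ) (a p) z k
  exact this.le.trans (hC k hk p z)

end HasUniformBounds

end UniformBounds

/-! ### Decay of oscillatory integrals with nonsmooth amplitude -/

section Decay

theorem hasFDerivAt_osc_comp {E : Type*} [NormedAddCommGroup E] [NormedSpace ℝ E]
    (L : E →L[ℝ] ℝ) (z : E) :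
    HasFDerivAt (fun z => osc (L z)) ((2 * Real.pi * Complex.I * osc (L z)) •
      (Complex.ofRealCLM.comp L)) z := by
  have := (hasDerivAt_osc (L z)).hasFDerivAt.comp z L.hasFDerivAt
  refine this.congr_fderiv ?_
  ext v
  simp [mul_comm]

theorem contDiff_osc_comp {E : Type*} [NormedAddCommGroup E] [NormedSpace ℝ E]
    (L : E →L[ℝ] ℝ) : ContDiff ℝ ∞ (fun z => osc (L z)) :=
  contDiff_osc.comp L.contDiff

theorem integral_inv_one_add_norm_sub_pow {E : Type*} [NormedAddCommGroup E]
    [MeasurableSpace E] [BorelSpace E] {μ : Measure E} [μ.IsAddRightInvariant] (M : ℕ) (c : E) :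
    ∫ z, ((1 + ‖z - c‖) ^ M)⁻¹ ∂μ = ∫ z, ((1 + ‖z‖) ^ M)⁻¹ ∂μ :=
  integral_sub_right_eq_self (fun z : E => ((1 + ‖z‖) ^ M)⁻¹) c

variable {ι E : Type*} [NormedAddCommGroup E] [NormedSpace ℝ E] [FiniteDimensional ℝ E]
  [MeasurableSpace E] [BorelSpace E] {μ : Measure E} [μ.IsAddHaarMeasure]

theorem integrable_inv_one_add_norm_sub_pow {M : ℕ} (hM : Module.finrank ℝ E < M) (c : E) :
    Integrable (fun z => ((1 + ‖z - c‖) ^ M)⁻¹) μ := by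
  have h := integrable_one_add_norm (E := E) (μ := μ) (r := M) (mod_cast hM)
  refine (h.comp_sub_right c).congr (Filter.Eventually.of_forall fun z => ?_)
  simp only
  rw [Real.rpow_neg (by positivity), Real.rpow_natCast]

namespace HasUniformBounds

variable {M : ℕ} {c : ι → E} {a : ι → E → ℂ} {K : ℕ}

theorem integrable (h : HasUniformBounds K (fun p z => ((1 + ‖z - c p‖) ^ M)⁻¹) a)
    (hM : Module.finrank ℝ E < M) (p : ι) : Integrable (a p) μ := by
  obtain ⟨C, hC0, hC⟩ := h.bound
  refine ((integrable_inv_one_add_norm_sub_pow hM (c p)).const_mul C).mono'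
    (h.smooth p).continuous.aestronglyMeasurable (Filter.Eventually.of_forall fun z => ?_)
  simpa using hC 0 (Nat.zero_le _) p z

theorem integrable_mul_osc (h : HasUniformBounds K (fun p z => ((1 + ‖z - c p‖) ^ M)⁻¹) a)
    (hM : Module.finrank ℝ E < M) (p : ι) (L : E →L[ℝ] ℝ) :
    Integrable (fun z => a p z * osc (L z)) μ :=
  (h.integrable hM p).mul_bdd (c := 1) (contDiff_osc_comp L).continuous.aestronglyMeasurable
    (Filter.Eventually.of_forall fun _ => (norm_osc _).le)

theorem exists_norm_integral_le (h : HasUniformBounds K (fun p z => ((1 + ‖z - c p‖) ^ M)⁻¹) a)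
    (hM : Module.finrank ℝ E < M) {σ : E → ℂ} (hσ : MemLp σ ⊤ μ) :
    ∃ C, ∀ p (L : E →L[ℝ] ℝ), ‖∫ z, σ z * (a p z * osc (L z)) ∂μ‖ ≤ C := by
  obtain ⟨C, hC0, hC⟩ := h.bound
  obtain ⟨S, hS0, hS⟩ := hσ.exists_ae_norm_le
  refine ⟨S * C * ∫ z, ((1 + ‖z‖) ^ M)⁻¹ ∂μ, fun p L => ?_⟩
  rw [← integral_inv_one_add_norm_sub_pow M (c p), ← integral_const_mul]
  refine norm_integral_le_of_norm_le
    ((integrable_inv_one_add_norm_sub_pow hM (c p)).const_mul _) ?_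
  filter_upwards [hS] with z hz
  rw [norm_mul, norm_mul, norm_osc, mul_one, mul_assoc]
  gcongr
  simpa using hC 0 (Nat.zero_le _) p z

/-- Oscillatory integrals decay to the order to which the amplitude has bounded weak derivatives,
uniformly over families of smooth factors with uniform bounds. -/
theorem exists_pow_mul_norm_integral_le (hM : Module.finrank ℝ E < M) (v : E) {σ : ℕ → E → ℂ}
    {J : ℕ} (hσ : ∀ j ≤ J, MemLp (σ j) ⊤ μ)
    (hweak : ∀ j < J, IsWeakDeriv μ v (σ j) (σ (j + 1))) (k : ℕ) :
    ∀ (a : ι → E → ℂ), HasUniformBounds k (fun p z => ((1 + ‖z - c p‖) ^ M)⁻¹) a →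
      ∀ j, j + k ≤ J → ∃ C, ∀ p (L : E →L[ℝ] ℝ),
        |L v| ^ k * ‖∫ z, σ j z * (a p z * osc (L z)) ∂μ‖ ≤ C := by
  induction k with
  | zero =>
    intro a ha j hj
    simpa using ha.exists_norm_integral_le hM (hσ j hj)
  | succ k ih =>
    intro a ha j hj
    -- One integration by parts along `v` gains a factor `L v`. The derivative falls either on the
    -- symbol, raising `j`, or on the smooth factor, lowering its order of control; hence the
    -- induction runs over all `a` and `j`.
    obtain ⟨C₁, hC₁⟩ := ih a (ha.of_le k.le_succ) (j + 1) (by lia)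
    obtain ⟨C₂, hC₂⟩ := ih _ (ha.fderiv_apply v) j (by lia)
    refine ⟨C₁ + C₂, fun p L => ?_⟩
    have hderiv : ∀ z, fderiv ℝ (fun z => a p z * osc (L z)) z v =
        fderiv ℝ (a p) z v * osc (L z) +
          2 * Real.pi * Complex.I * L v * (a p z * osc (L z)) := fun z => by
      rw [fderiv_fun_mul ((ha.smooth p).differentiable (by simp) z)
        (hasFDerivAt_osc_comp L z).differentiableAt, (hasFDerivAt_osc_comp L z).fderiv]
      simp
      ring
    have hi := ha.integrable_mul_osc (μ := μ) hM p L
    have hi' := (ha.fderiv_apply v).integrable_mul_osc (μ := μ) hM p L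
    have hj' : MemLp (σ j) ⊤ μ := hσ j (by lia)
    have hparts := (hweak j (by lia)).integral_mul_fderiv hj' (hσ (j + 1) (by lia))
      ((ha.smooth p).mul (contDiff_osc_comp L)) hi (by
        simp only [hderiv]
        exact hi'.add (hi.const_mul _))
    have hsplit : ∫ z, σ j z * fderiv ℝ (fun z => a p z * osc (L z)) z v ∂μ =
        ∫ z, σ j z * (fderiv ℝ (a p) z v * osc (L z)) ∂μ +
          2 * Real.pi * Complex.I * L v * ∫ z, σ j z * (a p z * osc (L z)) ∂μ := by
      rw [← integral_const_mul, ← integral_add (hj'.top_mul_integrable hi')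
        ((hj'.top_mul_integrable hi).const_mul _)]
      refine integral_congr_ae (Filter.Eventually.of_forall fun z => ?_)
      simp only [hderiv]
      ring
    rw [hsplit] at hparts
    set I₀ := ∫ z, σ j z * (a p z * osc (L z)) ∂μ
    set I₁ := ∫ z, σ (j + 1) z * (a p z * osc (L z)) ∂μ
    set I₂ := ∫ z, σ j z * (fderiv ℝ (a p) z v * osc (L z)) ∂μ
    have heq : 2 * Real.pi * Complex.I * L v * I₀ = -I₁ - I₂ := by linear_combination hparts
    have hnorm : |L v| * ‖I₀‖ ≤ ‖I₁‖ + ‖I₂‖ := by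
      calc |L v| * ‖I₀‖ ≤ 2 * Real.pi * (|L v| * ‖I₀‖) :=
            le_mul_of_one_le_left (by positivity) one_le_two_pi
        _ = ‖2 * Real.pi * Complex.I * L v * I₀‖ := by
            rw [norm_mul, norm_mul, norm_two_pi_I, Complex.norm_real, Real.norm_eq_abs]
            ring
        _ ≤ ‖I₁‖ + ‖I₂‖ := by
            rw [heq]
            exact (norm_sub_le _ _).trans_eq (by rw [norm_neg])
    calc |L v| ^ (k + 1) * ‖I₀‖ = |L v| ^ k * (|L v| * ‖I₀‖) := by ring
      _ ≤ |L v| ^ k * (‖I₁‖ + ‖I₂‖) := by gcongr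
      _ = |L v| ^ k * ‖I₁‖ + |L v| ^ k * ‖I₂‖ := by ring
      _ ≤ C₁ + C₂ := add_le_add (hC₁ p L) (hC₂ p L)

end HasUniformBounds

end Decay

/-! ### Matrix coefficients of the Fourier integral operator -/

/-- Meant for the coordinate projections `P`: each window decays only in its own variable, and the
product of the two decays in all of phase space. -/
theorem SchwartzMap.hasUniformBounds_comp_sub {E F : Type*} [NormedAddCommGroup E]
    [NormedSpace ℝ E] [NormedAddCommGroup F] [NormedSpace ℝ F] (g : SchwartzMap F ℂ)
    {P : E →L[ℝ] F} (hP : ‖P‖ ≤ 1) (K M : ℕ) :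
    HasUniformBounds K (fun p z : E => ((1 + ‖P z - P p‖) ^ M)⁻¹)
      (fun p z => g (P z - P p)) := by
  have hg : ContDiff ℝ ∞ g := g.smooth ⊤
  have heq : ∀ p : E, (fun z => g (P z - P p)) = fun z => (g ∘ P) (z - p) := fun p => by
    funext z
    simp
  refine ⟨fun p => ?_, 2 ^ M * ((Finset.Iic (M, K)).sup
    fun m => SchwartzMap.seminorm ℝ m.1 m.2) g, by positivity, fun k hk p z => ?_⟩
  · exact hg.comp (P.contDiff.sub contDiff_const)
  · rw [heq, iteratedFDeriv_comp_sub, P.iteratedFDeriv_comp_right hg _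
      (mod_cast le_top : ((k : ℕ∞) : WithTop ℕ∞) ≤ ∞)]
    refine (ContinuousMultilinearMap.norm_compContinuousLinearMap_le _ _).trans ?_
    have h1 : ∏ _i : Fin k, ‖P‖ ≤ 1 := by
      rw [Finset.prod_const]
      exact pow_le_one₀ (norm_nonneg _) hP
    refine (mul_le_of_le_one_right (norm_nonneg _) h1).trans ?_
    rw [map_sub, ← div_eq_mul_inv, le_div_iff₀ (by positivity), mul_comm]
    exact SchwartzMap.one_add_le_sup_seminorm_apply (𝕜 := ℝ) (m := (M, K)) le_rfl hk g _

namespace FourierOp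

variable {d : ℕ}

/-- Removing the linear part at `p` leaves a gradient of at most linear growth in `z - p`, while
higher derivatives stay bounded. The common form `D ^ i` with `1 ≤ D` is what the estimate for
derivatives of a composition takes as input. -/
theorem IsPhase.exists_norm_iteratedFDeriv_sub_le {Φ : Phase d → ℝ} (hΦ : IsPhase Φ) (K : ℕ) :
    ∃ B, 1 ≤ B ∧ ∀ i, 1 ≤ i → i ≤ K → ∀ p z,
      ‖iteratedFDeriv ℝ i (fun z => Φ z - fderiv ℝ Φ p z) z‖ ≤ (B * (1 + ‖z - p‖)) ^ i := by
  obtain ⟨C, hC0, hC⟩ := hΦ.exists_norm_hess_le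
  choose! b hb using hΦ.bounded
  set B := 1 + C + ∑ i ∈ Finset.range (K + 1), |b i| with hB
  have hsum : 0 ≤ ∑ i ∈ Finset.range (K + 1), |b i| := Finset.sum_nonneg fun _ _ => abs_nonneg _
  have hB1 : 1 ≤ B := by linarith
  refine ⟨B, hB1, fun i hi1 hiK p z => ?_⟩
  have hfd : fderiv ℝ (fun z => Φ z - fderiv ℝ Φ p z) = fun z => fderiv ℝ Φ z - fderiv ℝ Φ p := by
    funext y
    exact ((hΦ.differentiable y).hasFDerivAt.sub (fderiv ℝ Φ p).hasFDerivAt).fderiv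
  obtain rfl | hi2 := hi1.eq_or_lt
  · rw [norm_iteratedFDeriv_one, hfd, pow_one]
    have : ‖fderiv ℝ Φ z - fderiv ℝ Φ p‖ ≤ C * ‖z - p‖ :=
      Convex.norm_image_sub_le_of_norm_fderiv_le (𝕜 := ℝ) (s := Set.univ) (f := fderiv ℝ Φ)
        (fun y _ => (hΦ.hasFDerivAt_fderiv y).differentiableAt) (fun y _ => hC y) convex_univ
        (Set.mem_univ p) (Set.mem_univ z)
    refine this.trans ?_
    gcongr
    · linarith
    · linarith
  · obtain ⟨j, rfl⟩ := Nat.exists_eq_add_of_le' hi2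
    have heq : ‖iteratedFDeriv ℝ (j + 2) (fun z => Φ z - fderiv ℝ Φ p z) z‖ =
        ‖iteratedFDeriv ℝ (j + 2) Φ z‖ := by
      rw [← norm_iteratedFDeriv_fderiv, ← norm_iteratedFDeriv_fderiv,
        ← norm_iteratedFDeriv_fderiv (f := Φ), ← norm_iteratedFDeriv_fderiv (f := fderiv ℝ Φ), hfd]
      congr 2
      funext y
      exact fderiv_sub_const _
    have hbi : b (j + 2) ≤ B := by
      have := Finset.single_le_sum (f := fun i => |b i|) (fun _ _ => abs_nonneg _)
        (Finset.mem_range_succ_iff.2 hiK)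
      linarith [le_abs_self (b (j + 2))]
    have hB' : B ≤ B * (1 + ‖z - p‖) :=
      le_mul_of_one_le_right (by linarith) (by linarith [norm_nonneg (z - p)])
    rw [heq]
    calc ‖iteratedFDeriv ℝ (j + 2) Φ z‖ ≤ B * (1 + ‖z - p‖) :=
          ((hb (j + 2) (by lia) z).trans hbi).trans hB'
      _ ≤ (B * (1 + ‖z - p‖)) ^ (j + 2) := le_self_pow₀ (hB1.trans hB') (by lia)

/-- The Taylor remainder of order two of the phase oscillates with polynomially bounded
derivatives. -/
theorem IsPhase.hasUniformBounds_osc {Φ : Phase d → ℝ} (hΦ : IsPhase Φ) (K : ℕ) :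
    HasUniformBounds K (fun p z : Phase d => (1 + ‖z - p‖) ^ K)
      (fun p z => osc (Φ z - fderiv ℝ Φ p z)) := by
  obtain ⟨B, hB1, hB⟩ := hΦ.exists_norm_iteratedFDeriv_sub_le K
  have hs : ∀ p : Phase d, ContDiff ℝ ∞ (fun z => Φ z - fderiv ℝ Φ p z) := fun p =>
    hΦ.smooth.sub (fderiv ℝ Φ p).contDiff
  refine ⟨fun p => contDiff_osc.comp (hs p), K.factorial * (2 * Real.pi) ^ K * B ^ K,
    by positivity, fun k hk p z => ?_⟩
  have hD : 1 ≤ B * (1 + ‖z - p‖) :=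
    one_le_mul_of_one_le_of_one_le hB1 (by linarith [norm_nonneg (z - p)])
  have h := norm_iteratedFDeriv_comp_le contDiff_osc (hs p)
    (mod_cast le_top : ((k : ℕ∞) : WithTop ℕ∞) ≤ ∞) z
    (C := (2 * Real.pi) ^ K) (D := B * (1 + ‖z - p‖))
    (fun i hi => by
      rw [norm_iteratedFDeriv_osc]
      exact pow_le_pow_right₀ one_le_two_pi (hi.trans hk))
    (fun i hi1 hi => hB i hi1 (hi.trans hk) p z)
  refine h.trans ?_
  calc (k.factorial : ℝ) * (2 * Real.pi) ^ K * (B * (1 + ‖z - p‖)) ^ k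
      ≤ K.factorial * (2 * Real.pi) ^ K * (B * (1 + ‖z - p‖)) ^ K := by
        gcongr
    _ = K.factorial * (2 * Real.pi) ^ K * B ^ K * (1 + ‖z - p‖) ^ K := by
        rw [mul_pow B, mul_assoc _ (B ^ K)]

/-- The smooth factor of the amplitude, localized near the point `p` of phase space. -/
noncomputable def amplitude (Φ : Phase d → ℝ) (g : SchwartzMap (Eu d) ℂ) (p z : Phase d) : ℂ :=
  osc (Φ z - fderiv ℝ Φ p z) * ((starRingEnd ℂ) (g (z.1 - p.1)) * 𝓕 g (z.2 - p.2))

/-- The windows are given decay of order `K + M`: `K` powers absorb the growth of the oscillating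
factor and `M` remain. -/
theorem IsPhase.hasUniformBounds_amplitude {Φ : Phase d → ℝ} (hΦ : IsPhase Φ)
    (g : SchwartzMap (Eu d) ℂ) (K M : ℕ) :
    HasUniformBounds K (fun p z : Phase d => ((1 + ‖z - p‖) ^ M)⁻¹) (amplitude Φ g) := by
  have h1 := (g.hasUniformBounds_comp_sub
    (ContinuousLinearMap.norm_fst_le ℝ (Eu d) (Eu d)) K (K + M)).conj
  have h2 := (𝓕 g).hasUniformBounds_comp_sub
    (ContinuousLinearMap.norm_snd_le ℝ (Eu d) (Eu d)) K (K + M)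
  have h3 := (hΦ.hasUniformBounds_osc K).mul (h1.mul h2 (fun p z => by positivity)
    (fun p z => by positivity)) (fun p z => by positivity) (fun p z => by positivity)
  refine h3.mono fun p z => ?_
  set r := ‖z.1 - p.1‖ with hr
  set s := ‖z.2 - p.2‖ with hs
  have hr0 : 0 ≤ r := norm_nonneg _
  have hs0 : 0 ≤ s := norm_nonneg _
  have hle : 1 + ‖z - p‖ ≤ (1 + r) * (1 + s) := by
    have : ‖z - p‖ ≤ r + s := max_le (by change r ≤ r + s; linarith) (by change s ≤ r + s; linarith)
    nlinarith
  change (1 + ‖z - p‖) ^ K * (((1 + r) ^ (K + M))⁻¹ * ((1 + s) ^ (K + M))⁻¹) ≤ _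
  rw [← mul_inv, ← mul_pow]
  calc (1 + ‖z - p‖) ^ K * (((1 + r) * (1 + s)) ^ (K + M))⁻¹
      ≤ (1 + ‖z - p‖) ^ K * ((1 + ‖z - p‖) ^ (K + M))⁻¹ := by gcongr
    _ = ((1 + ‖z - p‖) ^ M)⁻¹ := by
        rw [pow_add]
        field_simp

/-! ### Reduction of matrix coefficients to oscillatory integrals. -/

/-- The successive weak derivatives of a symbol in a coordinate direction. -/
theorem IsSymbol.exists_isWeakDeriv {J : ℕ} {σ : Phase d → ℂ} (hσ : IsSymbol J σ)
    (i : Fin d ⊕ Fin d) : ∃ s : ℕ → Phase d → ℂ, s 0 = σ ∧ (∀ j ≤ J, MemLp (s j) ⊤ volume) ∧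
      ∀ j < J, IsWeakDeriv volume (phaseVec i) (s j) (s (j + 1)) := by
  have hex : ∀ j, ∃ w : Phase d → ℂ, j ≤ J → (j = 0 → w = σ) ∧ MemLp w ⊤ volume ∧
      IsWeakPartial (fun _ : Fin j => i) σ w := fun j => by
    rcases j with _ | j
    · exact ⟨σ, fun _ => ⟨fun _ => rfl, hσ.1, fun φ _ _ => by simp⟩⟩
    · by_cases hj : j + 1 ≤ J
      · obtain ⟨w, hw⟩ := hσ.2 (j + 1) hj fun _ => i
        exact ⟨w, fun _ => ⟨fun h => absurd h (Nat.succ_ne_zero j), hw⟩⟩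
      · exact ⟨σ, fun h => absurd h hj⟩
  choose s hs using hex
  refine ⟨s, (hs 0 (Nat.zero_le _)).1 rfl, fun j hj => (hs j hj).2.1, fun j hj φ hφ hφc => ?_⟩
  have hφ' : ContDiff ℝ ∞ (fderiv ℝ φ) := hφ.fderiv_right (by simp)
  -- Testing the order `j` derivative against `∂_i φ` and the order `j + 1` derivative against `φ`
  -- gives the same left side; cancelling `(-1) ^ j` leaves the one-step relation.
  have h1 := (hs j hj.le).2.2 (fun z => fderiv ℝ φ z (phaseVec i))
    (hφ'.clm_apply contDiff_const) (hφc.fderiv_apply ℝ _)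
  have h2 := (hs (j + 1) hj).2.2 φ hφ hφc
  have h3 : ∀ z, iteratedFDeriv ℝ (j + 1) φ z (fun _ => phaseVec i) =
      iteratedFDeriv ℝ j (fun z => fderiv ℝ φ z (phaseVec i)) z (fun _ => phaseVec i) := fun z => by
    rw [iteratedFDeriv_succ_apply_right, iteratedFDeriv_clm_apply_const_apply hφ'
      (mod_cast le_top : ((j : ℕ∞) : WithTop ℕ∞) ≤ ∞)]
    rfl
  simp only [h3] at h2
  rw [h2, pow_succ] at h1
  have h4 : ((-1 : ℂ) ^ j) ≠ 0 := pow_ne_zero _ (by norm_num)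
  refine mul_left_cancel₀ h4 ?_
  rw [← h1]
  ring

theorem fourier_gaborAtom (g : Eu d → ℂ) (m n η : Eu d) :
    𝓕 (gaborAtom g m n) η = osc (inner ℝ m n - inner ℝ m η) * 𝓕 g (η - n) := by
  rw [Real.fourier_eq', Real.fourier_eq', ← integral_const_mul]
  refine Eq.trans ?_ (integral_sub_right_eq_self _ m)
  refine integral_congr_ae (Filter.Eventually.of_forall fun t => ?_)
  have hexp : Complex.exp (((-2 * Real.pi * inner ℝ t η : ℝ) : ℂ) * Complex.I) *
      Complex.exp (2 * Real.pi * Complex.I * (inner ℝ n t : ℂ)) =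
      osc (inner ℝ m n - inner ℝ m η) *
        Complex.exp (((-2 * Real.pi * inner ℝ (t - m) (η - n) : ℝ) : ℂ) * Complex.I) := by
    rw [osc, ← Complex.exp_add, ← Complex.exp_add, inner_sub_left, inner_sub_right,
      inner_sub_right, real_inner_comm n t]
    congr 1
    push_cast
    ring
  simp only [gaborAtom, smul_eq_mul]
  linear_combination g (t - m) * hexp

/-- The linear phase left in a matrix coefficient after removing the Taylor remainder. -/
noncomputable def defect (Φ : Phase d → ℝ) (m n m' n' : Eu d) : Phase d →L[ℝ] ℝ :=
  fderiv ℝ Φ (m', n) - ((innerSL ℝ n').comp (.fst ℝ (Eu d) (Eu d)) +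
    (innerSL ℝ m).comp (.snd ℝ (Eu d) (Eu d)))

theorem defect_apply (Φ : Phase d → ℝ) (m n m' n' : Eu d) (z : Phase d) :
    defect Φ m n m' n' z = fderiv ℝ Φ (m', n) z - (inner ℝ n' z.1 + inner ℝ m z.2) := by
  simp [defect]

/-- The coefficients of the residual linear phase are the errors of `(m', n')` in the equations
generating `χ`; this ties oscillation to geometry. -/
theorem defect_inl {Φ : Phase d → ℝ} (hΦ : Differentiable ℝ Φ) (m n m' n' : Eu d) (i : Fin d) :
    defect Φ m n m' n' (phaseVec (Sum.inl i)) = (gradX Φ m' n - n') i := by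
  rw [← inner_stdVec_right, inner_sub_left, gradX_eq_rieszComp hΦ, inner_rieszComp_left,
    defect_apply]
  simp [phaseVec]

theorem defect_inr {Φ : Phase d → ℝ} (hΦ : Differentiable ℝ Φ) (m n m' n' : Eu d) (i : Fin d) :
    defect Φ m n m' n' (phaseVec (Sum.inr i)) = (gradEta Φ m' n - m) i := by
  rw [← inner_stdVec_right, inner_sub_left, gradEta_eq_rieszComp hΦ, inner_rieszComp_left,
    defect_apply]
  simp [phaseVec]

instance isAddHaarMeasure_volume_phase : (volume : Measure (Phase d)).IsAddHaarMeasure :=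
  inferInstanceAs ((volume : Measure (Eu d)).prod volume).IsAddHaarMeasure

theorem finrank_lt : Module.finrank ℝ (Phase d) < 2 * d + 1 := by
  simp
  lia

theorem conj_osc (t : ℝ) : (starRingEnd ℂ) (osc t) = osc (-t) := by
  rw [osc, osc, ← Complex.exp_conj]
  simp [Complex.conj_ofNat]

/-- Up to a unimodular constant, the matrix coefficients of a Fourier integral operator are
oscillatory integrals over phase space. -/
theorem norm_pairing_fio {Φ : Phase d → ℝ} (hΦ : IsPhase Φ) {σ : Phase d → ℂ}
    (hσ : MemLp σ ⊤ volume) (g : SchwartzMap (Eu d) ℂ) (m n m' n' : Eu d) :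
    ‖pairing (fio Φ σ (gaborAtom g m n)) (gaborAtom g m' n')‖ =
      ‖∫ z, σ z * (amplitude Φ g (m', n) z * osc (defect Φ m n m' n' z))‖ := by
  have hi : Integrable (fun z => σ z * (amplitude Φ g (m', n) z * osc (defect Φ m n m' n' z))) :=
    hσ.top_mul_integrable
      ((hΦ.hasUniformBounds_amplitude g 0 (2 * d + 1)).integrable_mul_osc finrank_lt _ _)
  have hpair : pairing (fio Φ σ (gaborAtom g m n)) (gaborAtom g m' n') =
      osc (inner ℝ m n) *
        ∫ z, σ z * (amplitude Φ g (m', n) z * osc (defect Φ m n m' n' z)) := by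
    rw [Measure.volume_eq_prod] at hi ⊢
    rw [integral_prod _ hi, ← integral_const_mul, pairing]
    congr 1
    funext x
    rw [fio, ← integral_mul_const, ← integral_const_mul]
    congr 1
    funext η
    have h1 : gaborAtom g m' n' x = osc (inner ℝ n' x) * g (x - m') := rfl
    have h2 : Complex.exp (2 * Real.pi * Complex.I * (Φ (x, η) : ℂ)) = osc (Φ (x, η)) := rfl
    -- The total phase splits into the constant `m·n`, the remainder of `Φ` at `(m', n)` and the
    -- linear defect.
    have h3 : osc (Φ (x, η)) * osc (inner ℝ m n - inner ℝ m η) * osc (-inner ℝ n' x) =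
        osc (inner ℝ m n) * osc (Φ (x, η) - fderiv ℝ Φ (m', n) (x, η)) *
          osc (defect Φ m n m' n' (x, η)) := by
      rw [← osc_add, ← osc_add, ← osc_add, ← osc_add, defect_apply]
      congr 1
      simp only
      ring
    rw [fourier_gaborAtom, h1, h2, map_mul, conj_osc, amplitude, SchwartzMap.fourier_coe]
    linear_combination (σ (x, η) * 𝓕 (g : Eu d → ℂ) (η - n) *
      (starRingEnd ℂ) (g (x - m'))) * h3
  rw [hpair, norm_mul, norm_osc, one_mul]

theorem exists_abs_defect_pow_mul_le {Φ : Phase d → ℝ} (hΦ : IsPhase Φ) {J : ℕ} {σ : Phase d → ℂ}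
    (hσ : IsSymbol J σ) (g : SchwartzMap (Eu d) ℂ) (i : Fin d ⊕ Fin d) :
    ∃ C, ∀ m n m' n' : Eu d, |defect Φ m n m' n' (phaseVec i)| ^ J *
      ‖pairing (fio Φ σ (gaborAtom g m n)) (gaborAtom g m' n')‖ ≤ C := by
  obtain ⟨s, rfl, hs, hweak⟩ := hσ.exists_isWeakDeriv i
  obtain ⟨C, hC⟩ := HasUniformBounds.exists_pow_mul_norm_integral_le finrank_lt (phaseVec i) hs
    hweak J (amplitude Φ g) (hΦ.hasUniformBounds_amplitude g J (2 * d + 1)) 0 (by lia)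
  exact ⟨C, fun m n m' n' => by
    rw [norm_pairing_fio hΦ hσ.1]
    exact hC (m', n) (defect Φ m n m' n')⟩

/-! ### From coordinate residuals to the bracket. -/

theorem exists_norm_pairing_le {Φ : Phase d → ℝ} (hΦ : IsPhase Φ) {σ : Phase d → ℂ}
    (hσ : MemLp σ ⊤ volume) (g : SchwartzMap (Eu d) ℂ) :
    ∃ C, ∀ m n m' n' : Eu d,
      ‖pairing (fio Φ σ (gaborAtom g m n)) (gaborAtom g m' n')‖ ≤ C := by
  obtain ⟨C, hC⟩ := (hΦ.hasUniformBounds_amplitude g 0 (2 * d + 1)).exists_norm_integral_le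
    finrank_lt hσ
  exact ⟨C, fun m n m' n' => by
    rw [norm_pairing_fio hΦ hσ]
    exact hC (m', n) (defect Φ m n m' n')⟩

theorem norm_grad_sub_le {Φ : Phase d → ℝ} (hΦ : Differentiable ℝ Φ) (m n m' n' : Eu d) :
    ‖gradX Φ m' n - n'‖ + ‖gradEta Φ m' n - m‖ ≤
      ∑ i, |defect Φ m n m' n' (phaseVec i)| := by
  rw [Fintype.sum_sum_type]
  simp only [defect_inl hΦ, defect_inr hΦ]
  exact add_le_add (norm_le_sum_abs _) (norm_le_sum_abs _)

/-- The norm on `Phase d` is the maximum of the two Euclidean norms, whence the factor on the right.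
-/
theorem bracket_le (q : Phase d) : bracket q ≤ 1 + 2 * ‖q‖ := by
  rw [bracket]
  refine Real.sqrt_le_iff.2 ⟨by positivity, ?_⟩
  have h1 := norm_fst_le q
  have h2 := norm_snd_le q
  nlinarith [norm_nonneg q.1, norm_nonneg q.2, norm_nonneg q]

theorem bracket_pos (q : Phase d) : 0 < bracket q :=
  Real.sqrt_pos.2 (by positivity)

/-- The matrix coefficients of a Fourier integral operator with respect to time-frequency shifts
of a Schwartz function decay away from the graph of the canonical transformation. -/
theorem IsPhase.exists_norm_pairing_le_bracket {Φ : Phase d → ℝ} (hΦ : IsPhase Φ) {N : ℕ}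
    {σ : Phase d → ℂ} (hσ : IsSymbol (2 * N) σ) (g : SchwartzMap (Eu d) ℂ) :
    ∃ χ : Phase d ≃ Phase d, IsCanonicalTransformation χ ∧ IsGeneratedBy Φ χ ∧
      ∃ C : ℝ, 0 < C ∧ ∀ m n m' n' : Eu d,
        ‖pairing (fio Φ σ (gaborAtom g m n)) (gaborAtom g m' n')‖ ≤
          C * bracket (χ (m, n) - (m', n')) ^ (-(2 * (N : ℤ))) := by
  obtain ⟨χ, hχ, hgen, K, hK0, hK⟩ := hΦ.exists_canonicalTransformation
  refine ⟨χ, hχ, hgen, ?_⟩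
  obtain ⟨C₀, hC₀⟩ := exists_norm_pairing_le hΦ hσ.1 g
  choose C hC using exists_abs_defect_pow_mul_le hΦ hσ g
  set D : ℝ := |C₀| + ∑ i, |C i| with hD
  have hsum : 0 ≤ ∑ i, |C i| := Finset.sum_nonneg fun _ _ => abs_nonneg _
  have hD0 : 0 ≤ D := by positivity
  set A : ℝ := 1 + 2 * (K * (2 * d)) with hA
  have hA0 : 0 < A := by positivity
  refine ⟨A ^ (2 * N) * D + 1, by positivity, fun m n m' n' => ?_⟩
  set P := ‖pairing (fio Φ σ (gaborAtom g m n)) (gaborAtom g m' n')‖ with hP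
  set q := χ (m, n) - (m', n') with hq
  -- The value `1` at `none` stands for the trivial bound without integration by parts. The largest
  -- of `1` and the `2 * d` residuals dominates the bracket up to the constant `A`, so the single
  -- estimate belonging to it suffices.
  let f : Option (Fin d ⊕ Fin d) → ℝ := fun o =>
    o.elim 1 fun i => |defect Φ m n m' n' (phaseVec i)|
  have hf : ∀ o, f o ^ (2 * N) * P ≤ D := by
    rintro (_ | i)
    · have h1 : P ≤ C₀ := hC₀ m n m' n'
      simp only [f, Option.elim_none, one_pow, one_mul]
      linarith [le_abs_self C₀]
    · have h1 : f (some i) ^ (2 * N) * P ≤ C i := hC i m n m' n'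
      have h2 := Finset.single_le_sum (f := fun i => |C i|) (fun _ _ => abs_nonneg _)
        (Finset.mem_univ i)
      linarith [le_abs_self (C i), abs_nonneg C₀]
  obtain ⟨o, ho⟩ := Finite.exists_max f
  have ho1 : 1 ≤ f o := ho none
  have hbr : bracket q ≤ A * f o := by
    have h1 : ∑ i, |defect Φ m n m' n' (phaseVec i)| ≤ 2 * d * f o := by
      refine (Finset.sum_le_sum (g := fun _ => f o) fun i _ => ho (some i)).trans_eq ?_
      rw [Finset.sum_const, Finset.card_univ, Fintype.card_sum, Fintype.card_fin, nsmul_eq_mul]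
      push_cast
      ring
    calc bracket q ≤ 1 + 2 * ‖q‖ := bracket_le q
      _ ≤ 1 + 2 * (K * (2 * d * f o)) := by
          gcongr
          refine (hK m n m' n').trans ?_
          gcongr
          exact (norm_grad_sub_le hΦ.differentiable m n m' n').trans h1
      _ ≤ f o + 2 * (K * (2 * d * f o)) := by gcongr
      _ = A * f o := by rw [hA]; ring
  have hpos := bracket_pos q
  have hexp : (2 * (N : ℤ)) = ((2 * N : ℕ) : ℤ) := by push_cast; rfl
  rw [hexp, zpow_neg, zpow_natCast, ← div_eq_mul_inv, le_div_iff₀ (by positivity)]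
  calc P * bracket q ^ (2 * N) ≤ P * (A * f o) ^ (2 * N) := by gcongr
    _ = A ^ (2 * N) * (f o ^ (2 * N) * P) := by rw [mul_pow]; ring
    _ ≤ A ^ (2 * N) * D := by
        gcongr
        exact hf o
    _ ≤ A ^ (2 * N) * D + 1 := by linarith

end FourierOp

theorem theorem3p3 {d : ℕ} (N : ℕ) (Φ : FourierOp.Phase d → ℝ) (hΦ : FourierOp.IsPhase Φ)
    (σ : FourierOp.Phase d → ℂ) (hσ : FourierOp.IsSymbol (2 * N) σ)
    (g : SchwartzMap (FourierOp.Eu d) ℂ) (a b : ℝ) (ha : 0 < a) (hb : 0 < b) :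
    ∃ χ : FourierOp.Phase d ≃ FourierOp.Phase d,
      FourierOp.IsCanonicalTransformation χ ∧ FourierOp.IsGeneratedBy Φ χ ∧
      ∃ C : ℝ, 0 < C ∧
        ∀ m n m' n' : FourierOp.Eu d,
          (m, n) ∈ FourierOp.gaborLattice d a b → (m', n') ∈ FourierOp.gaborLattice d a b →
          ‖FourierOp.pairing (FourierOp.fio Φ σ (FourierOp.gaborAtom g m n)) (FourierOp.gaborAtom g m' n')‖
            ≤ C * FourierOp.bracket (χ (m, n) - (m', n')) ^ (-(2 * (N : ℤ))) := by
  obtain ⟨χ, hχ, hgen, C, hC0, hC⟩ := hΦ.exists_norm_pairing_le_bracket hσ g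
  exact ⟨χ, hχ, hgen, C, hC0, fun m n m' n' _ _ => hC m n m' n'⟩
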